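/- All locally compact groups are Hausdorff. A homomorphism $f:G\to H$ of locally compact groups is \emph{copci} if it is continuous, proper and has cocompact image. Write $G\nearrow K$ if there is a copci homomorphism $G\to K$ and $G\nwarrow K$ if there is a copci homomorphism $K\to G$; a \emph{commation} from $G$ to $H$ is a finite sequence of such arrows from $G$ to $H$ through locally compact groups, and $G,H$ are \emph{commable within a class} $\mathcal C$ if there is a commation all of whose groups ($G$ and $H$ included) belong to $\mathcal C$. A self-homeomorphism $\alpha$ of a Hausdorff space is \emph{compacting} if there is a compact set $\Omega$ such that for every compact set $K$ there is $n\ge1$ with $\alpha^n(K)\subset\Omega$. A locally compact group is \emph{focal} if it is topologically isomorphic to a topological semidirect product $N\rtimes\Lambda$ with $\Lambda\in\{\mathbf Z,\mathbf R\}$ and $N$ a noncompact locally compact group, such that every positive element of $\Lambda$ acts on $N$ as a compacting automorphism; it is \emph{of totally disconnected type} if moreover the identity component $N^\circ$ is compact. If $G=N\rtimes\mathbf Z$ is focal and $n\ge 1$, put $G^{[n]}=N\rtimes n\mathbf Z$. An integer $q\ge 1$ is a \emph{non-power} if it is not an integral power of a smaller positive integer. For $m\ge2$, $\mathrm{FT}_m$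 denotes the stabilizer of a boundary point in the automorphism group of an $(m+1)$-regular tree. \textbf{Proposition.} Let $G,H$ be focal locally compact groups of totally disconnected type. Then the image of the modular homomorphism of $G$ is the multiplicative group generated by an integer $s_G\ge 2$, and similarly for $H$; let $q_G$ be the minimal integer $\ge2$ having $s_G$ as an integral power, and similarly $q_H$. The following are equivalent: \begin{enumerate} \item $G$ and $H$ are commable within focal groups; \item $q_G=q_H$; \item $s_G^a=s_H^b$ for some integers $a,b\ge1$; \item the images of the modular homomorphisms of $G$ and $H$ are commensurate subgroups of the group of positive real numbers; \item there is a commation within focal groups $G\nearrow\nwarrow\nearrow\nwarrow H$; \item there are a non-power integer $q\ge2$ and an integer $n\ge1$ with commations within focal groups $G\nearrow\nwarrow \mathrm{FT}_q^{[n]}$ and $H\nearrow\nwarrow \mathrm{FT}_q^{[n]}$; \item there is a non-power integer $q\ge2$ with commations within focal groups $G\nearrow\nwarrow\nearrow \mathrm{FT}_q$ and $H\nearrow\nwarrow\nearrow \mathrm{FT}_q$; \item there is a commation within focal groups $G\nwarrow\nearrow\nwarrow\nearrow H$; \item there is an integer $m\ge2$ with commations within focal groups $G\nwarrow\nearrow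 \mathrm{FT}_m$ and $H\nwarrow\nearrow \mathrm{FT}_m$. \end{enumerate} Moreover, if these hold and $q=q_G=q_H$, then $q$ is a non-power integer and, writing $s_G=q^k$ and $s_H=q^l$ with $k,l\ge1$, there are an integer $n\ge1$ and copci homomorphisms between focal groups $$G\longrightarrow \mathrm{FT}_{q^k}\longleftarrow \mathrm{FT}_q^{[n]}\longrightarrow \mathrm{FT}_{q^l}\longleftarrow H .$$ -/

import Mathlib

open scoped NNReal Topology

universe u

/-! ### Topological groups, copci homomorphisms, commations -/

/-- A bundled topological group. -/
structure TopGroup : Type (u + 1) where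
  /-- The underlying type. -/
  carrier : Type u
  [group : Group carrier]
  [top : TopologicalSpace carrier]
  [topGroup : IsTopologicalGroup carrier]

namespace TopGroup

instance : CoeSort TopGroup.{u} (Type u) := ⟨TopGroup.carrier⟩

instance (G : TopGroup.{u}) : Group G := G.group
instance (G : TopGroup.{u}) : TopologicalSpace G := G.top
instance (G : TopGroup.{u}) : IsTopologicalGroup G := G.topGroup

/-- Bundle a topological group. -/
abbrev of (G : Type u) [Group G] [TopologicalSpace G] [IsTopologicalGroup G] : TopGroup.{u} :=
  ⟨G⟩

end TopGroup

/-- A locally compact group: the topology is locally compact and Hausdorff. -/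
def IsLCGroup (G : TopGroup.{u}) : Prop := LocallyCompactSpace G ∧ T2Space G

/-- There is a copci homomorphism `G → H`: a continuous proper homomorphism `f` with cocompact
image, i.e. with `H / f(G)` compact. (`IsProperMap` includes continuity.) -/
def Copci (G H : TopGroup.{u}) : Prop :=
  ∃ f : G →* H, IsProperMap f ∧ CompactSpace (H ⧸ f.range)

/-- The two directions of an arrow in a commation written from left to right:
`A ↗ B` is a copci homomorphism `A → B`, and `A ↖ B` is a copci homomorphism `B → A`. -/
inductive Arrow : Type
  | ne
  | nw

/-- `Commation C w G H`: there is a commation from `G` to `H` whose successive arrows are those of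
`w`, all of whose groups (including `G` and `H`) belong to the class `C`. -/
def Commation (C : TopGroup.{u} → Prop) : List Arrow → TopGroup.{u} → TopGroup.{u} → Prop
  | [], G, H => C G ∧ G = H
  | Arrow.ne :: w, G, H => C G ∧ ∃ K : TopGroup.{u}, Copci G K ∧ Commation C w K H
  | Arrow.nw :: w, G, H => C G ∧ ∃ K : TopGroup.{u}, Copci K G ∧ Commation C w K H

/-- `G` and `H` are commable within the class `C`. -/
def CommableWithin (C : TopGroup.{u} → Prop) (G H : TopGroup.{u}) : Prop :=
  ∃ w : List Arrow, Commation C w G H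

/-! ### Focal groups -/

/-- A self-map `α` of a topological space is compacting if there is a compact set `Ω` such that
every compact set is mapped into `Ω` by some positive iterate of `α`. -/
def IsCompacting {X : Type*} [TopologicalSpace X] (α : X → X) : Prop :=
  ∃ Ω : Set X, IsCompact Ω ∧ ∀ K : Set X, IsCompact K → ∃ n : ℕ, 1 ≤ n ∧ α^[n] '' K ⊆ Ω

/-- The product topology on a semidirect product. -/
instance {N L : Type*} [Group N] [Group L] [TopologicalSpace N] [TopologicalSpace L]
    (φ : L →* MulAut N) : TopologicalSpace (N ⋊[φ] L) :=
  TopologicalSpace.induced SemidirectProduct.equivProd inferInstance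

/-- A focal decomposition of `G` with respect to the ordered topological abelian group `Λ`
(which will be `ℤ` or `ℝ`): a topological isomorphism of `G` with a topological semidirect product
`N ⋊ Λ`, with `N` a noncompact locally compact group, such that each positive element of `Λ` acts
on `N` as a compacting automorphism. -/
structure FocalDecomposition (Λ : Type) [AddCommGroup Λ] [LT Λ] [TopologicalSpace Λ]
    (G : TopGroup.{u}) where
  /-- The kernel of the semidirect product. -/
  N : TopGroup.{u}
  isLCGroup : IsLCGroup N
  noncompact : ¬ CompactSpace N
  /-- The action of `Λ` on `N`. -/
  φ : Multiplicative Λ →* MulAut N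
  continuous_action : Continuous fun p : Multiplicative Λ × N => φ p.1 p.2
  compacting : ∀ t : Λ, 0 < t → IsCompacting (φ (Multiplicative.ofAdd t))
  /-- The topological isomorphism. -/
  iso : G ≃ₜ* (N ⋊[φ] Multiplicative Λ)

/-- Focal locally compact groups. -/
def IsFocal (G : TopGroup.{u}) : Prop :=
  IsLCGroup G ∧ (Nonempty (FocalDecomposition ℤ G) ∨ Nonempty (FocalDecomposition ℝ G))

/-- Focal locally compact groups of totally disconnected type: `G ≃ N ⋊ Λ` as above, and the
identity component of `N` is compact. -/
def IsFocalTD (G : TopGroup.{u}) : Prop :=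
  IsLCGroup G ∧
    ((∃ D : FocalDecomposition ℤ G, IsCompact (connectedComponent (1 : D.N))) ∨
      (∃ D : FocalDecomposition ℝ G, IsCompact (connectedComponent (1 : D.N))))

/-- For `G ≃ N ⋊ ℤ` focal, the subgroup `G^[n] ≃ N ⋊ nℤ`. -/
def FocalDecomposition.powSubgroup {G : TopGroup.{u}} (D : FocalDecomposition ℤ G) (n : ℕ) :
    Subgroup G :=
  (Subgroup.zpowers (Multiplicative.ofAdd (n : ℤ))).comap
    (SemidirectProduct.rightHom.comp D.iso.toMulEquiv.toMonoidHom)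

/-! ### The invariants `s` and `q` -/

section Invariants

variable (G : Type*) [Group G] [TopologicalSpace G] [IsTopologicalGroup G] [LocallyCompactSpace G]

/-- The image of the modular homomorphism of `G`, as a subgroup of the multiplicative group of
positive real numbers. -/
noncomputable def modularRange : Subgroup ℝ≥0ˣ :=
  (MonoidHom.toHomUnits (MeasureTheory.Measure.modularCharacter (G := G))).range

/-- The image of the modular homomorphism of `G` is `{s ^ k : k ∈ ℤ}`. -/
def ModularRangeGeneratedBy (s : ℕ) : Prop :=
  ∀ x : ℝ≥0, x ∈ Set.range (MeasureTheory.Measure.modularCharacter (G := G)) ↔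
    ∃ k : ℤ, x = (s : ℝ≥0) ^ k

/-- The integer `s_G ≥ 2` such that the image of the modular homomorphism is generated by `s_G`
(it is unique if it exists; the value is `0` if there is none). -/
noncomputable def sInvariant : ℕ :=
  sInf {s : ℕ | 2 ≤ s ∧ ModularRangeGeneratedBy G s}

/-- The invariant `q_G`: the minimal integer `≥ 2` having `s_G` as an integral power. -/
noncomputable def qInvariant : ℕ :=
  sInf {q : ℕ | 2 ≤ q ∧ ∃ k : ℕ, sInvariant G = q ^ k}

end Invariants

/-- A non-power integer: not an integral power of a smaller positive integer. -/
def IsNonPower (q : ℕ) : Prop := ¬ ∃ a k : ℕ, 0 < a ∧ a < q ∧ q = a ^ k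

/-! ### Automorphism groups of trees and their boundary stabilizers -/

section Trees

variable {V : Type u} (T : SimpleGraph V)

/-- The topology of pointwise convergence on the automorphism group of a graph. -/
instance SimpleGraph.autTopology : TopologicalSpace (T ≃g T) :=
  TopologicalSpace.induced (fun g v => g v) (@Pi.topologicalSpace V (fun _ => V) fun _ => ⊥)

theorem SimpleGraph.continuous_aut_iff {X : Type*} [TopologicalSpace X] {f : X → (T ≃g T)} :
    Continuous f ↔ ∀ v w : V, IsOpen {x | f x v = w} := by
  let _ : TopologicalSpace V := ⊥
  have : DiscreteTopology V := ⟨rfl⟩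
  rw [continuous_induced_rng, continuous_pi_iff]
  refine forall_congr' fun v => ?_
  rw [continuous_discrete_rng]
  rfl

theorem SimpleGraph.isOpen_aut (v w : V) : IsOpen {g : T ≃g T | g v = w} :=
  (SimpleGraph.continuous_aut_iff T (f := id)).1 continuous_id v w

instance SimpleGraph.autIsTopologicalGroup : IsTopologicalGroup (T ≃g T) where
  continuous_mul := by
    rw [SimpleGraph.continuous_aut_iff]
    intro v w
    have : {x : (T ≃g T) × (T ≃g T) | (x.1 * x.2) v = w} =
        ⋃ z : V, {g | g z = w} ×ˢ {g | g v = z} := by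
      ext ⟨g, h⟩
      simp [RelIso.mul_apply]
    rw [this]
    exact isOpen_iUnion fun z => (SimpleGraph.isOpen_aut T z w).prod (SimpleGraph.isOpen_aut T v z)
  continuous_inv := by
    rw [SimpleGraph.continuous_aut_iff]
    intro v w
    have : {x : T ≃g T | x⁻¹ v = w} = {g | g w = v} := by
      ext g
      change g⁻¹ v = w ↔ g w = v
      constructor
      · rintro rfl
        exact RelIso.apply_inv_self g v
      · rintro rfl
        exact RelIso.inv_apply_self g w
    rw [this]
    exact SimpleGraph.isOpen_aut T w v

/-- A ray in a graph: an infinite path without repetition. In a tree these are the geodesic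
rays. -/
structure TreeRay where
  /-- The vertices of the ray. -/
  vertex : ℕ → V
  adj : ∀ n, T.Adj (vertex n) (vertex (n + 1))
  injective : Function.Injective vertex

/-- Two rays are equivalent if they coincide up to a shift outside initial segments. -/
def TreeRay.setoid : Setoid (TreeRay T) where
  r x y := ∃ a b : ℕ, ∀ n, x.vertex (n + a) = y.vertex (n + b)
  iseqv :=
    { refl := fun _ => ⟨0, 0, fun _ => rfl⟩
      symm := fun ⟨a, b, h⟩ => ⟨b, a, fun n => (h n).symm⟩
      trans := by
        rintro x y z ⟨a, b, h⟩ ⟨c, d, k⟩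
        refine ⟨c + a, b + d, fun n => ?_⟩
        rw [← add_assoc, h (n + c), add_right_comm, k (n + b), add_assoc] }

/-- The boundary of a tree: the set of equivalence classes of geodesic rays. -/
def TreeBoundary : Type u := Quotient (TreeRay.setoid T)

/-- The image of a ray by an automorphism. -/
def TreeRay.map {T : SimpleGraph V} (g : T ≃g T) (x : TreeRay T) : TreeRay T where
  vertex n := g (x.vertex n)
  adj n := g.map_adj_iff.2 (x.adj n)
  injective := g.injective.comp x.injective

/-- The action of the automorphism group on the boundary. -/
instance TreeBoundary.mulAction : MulAction (T ≃g T) (TreeBoundary T) where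
  smul g := Quotient.map' (TreeRay.map g) fun _ _ ⟨a, b, h⟩ => ⟨a, b, fun n => congrArg g (h n)⟩
  one_smul ω := by
    induction ω using Quotient.inductionOn with
    | _ x => rfl
  mul_smul g h ω := by
    induction ω using Quotient.inductionOn with
    | _ x => rfl

end Trees

/-- An `(m + 1)`-regular tree together with a boundary point. -/
structure PointedRegularTree (m : ℕ) : Type (u + 1) where
  /-- The vertices. -/
  V : Type u
  /-- The tree. -/
  T : SimpleGraph V
  isTree : T.IsTree
  regular : ∀ v, (T.neighborSet v).ncard = m + 1
  /-- The boundary point. -/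
  ω : TreeBoundary T

/-- The group `FT_m`: the stabilizer of a boundary point in the automorphism group of an
`(m + 1)`-regular tree. -/
def FT {m : ℕ} (X : PointedRegularTree.{u} m) : TopGroup.{u} :=
  TopGroup.of (MulAction.stabilizer (X.T ≃g X.T) X.ω)

/-! ### Existence of regular trees -/

namespace RegularTree

/-- Words in which consecutive letters are distinct. -/
abbrev Word (A : Type u) : Type u := {l : List A // l.IsChain (· ≠ ·)}

/-- A word is joined to the words obtained by adding one letter in front. -/
def graph (A : Type u) : SimpleGraph (Word A) where
  Adj x y := (∃ a, y.1 = a :: x.1) ∨ (∃ a, x.1 = a :: y.1)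
  symm := ⟨fun _ _ h => h.symm⟩
  loopless := ⟨fun x h => by
    rcases h with ⟨a, h⟩ | ⟨a, h⟩ <;> simpa using congrArg List.length h⟩

theorem reachable_nil {A : Type u} : ∀ (l : List A) (h : l.IsChain (· ≠ ·)),
    (graph A).Reachable ⟨[], List.isChain_nil⟩ ⟨l, h⟩
  | [], _ => SimpleGraph.Reachable.refl _
  | a :: l, h => (reachable_nil l h.tail).trans
      (SimpleGraph.Adj.reachable (Or.inl ⟨a, rfl⟩))

theorem suffix_iff {A : Type u} {x : Word A} {a : A} {u v : Word A} (y : Word A)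
    (hy : y.1 = a :: x.1) (huv : ((graph A).deleteEdges {s(x, y)}).Adj u v) :
    y.1 <:+ u.1 ↔ y.1 <:+ v.1 := by
  have key : ∀ u v : Word A, s(u, v) ≠ s(x, y) → (∃ b, v.1 = b :: u.1) →
      (y.1 <:+ u.1 ↔ y.1 <:+ v.1) := by
    rintro u v hne ⟨b, hb⟩
    rw [hb, List.suffix_cons_iff]
    constructor
    · exact Or.inr
    · rintro (h | h)
      · exfalso
        apply hne
        have hv : v = y := Subtype.ext (hb.trans h.symm)
        have hu : u = x := by
          rw [hy] at h
          exact Subtype.ext (List.cons.inj h).2.symm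
        rw [hv, hu]
      · exact h
  rw [SimpleGraph.deleteEdges_adj] at huv
  obtain ⟨h, hne'⟩ := huv
  rcases h with h | h
  · exact key u v hne' h
  · exact (key v u (by rwa [Sym2.eq_swap]) h).symm

theorem not_reachable {A : Type u} {x y : Word A} {a : A} (hy : y.1 = a :: x.1) :
    ¬ ((graph A).deleteEdges {s(x, y)}).Reachable x y := by
  rintro ⟨p⟩
  have key : ∀ {u v : Word A}, ((graph A).deleteEdges {s(x, y)}).Walk u v →
      (y.1 <:+ u.1 ↔ y.1 <:+ v.1) := by
    intro u v p
    induction p with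
    | nil => rfl
    | cons h _ ih => exact (suffix_iff y hy h).trans ih
  have h := ((key p).2 List.suffix_rfl).length_le
  rw [hy, List.length_cons] at h
  omega

theorem isTree (A : Type u) : (graph A).IsTree := by
  refine ⟨?_, ?_⟩
  · rw [SimpleGraph.connected_iff_exists_forall_reachable]
    exact ⟨⟨[], List.isChain_nil⟩, fun x => reachable_nil x.1 x.2⟩
  · rw [SimpleGraph.isAcyclic_iff_forall_adj_isBridge]
    rintro x y (⟨a, h⟩ | ⟨a, h⟩)
    · exact SimpleGraph.isBridge_iff.2 (not_reachable h)
    · rw [Sym2.eq_swap]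
      exact SimpleGraph.isBridge_iff.2 (not_reachable h)

open Classical in
/-- Multiplication of a word by a letter, each letter being its own inverse. -/
noncomputable def letter {A : Type u} (x : Word A) (a : A) : Word A :=
  if h : x.1.head? = some a then ⟨x.1.tail, x.2.tail⟩ else
    ⟨a :: x.1, List.isChain_cons.2 ⟨fun _ hb e => h (e ▸ hb), x.2⟩⟩

theorem letter_injective {A : Type u} (x : Word A) : Function.Injective (letter x) := by
  intro a b h
  unfold letter at h
  split_ifs at h with h1 h2 h2
  · exact Option.some.inj (h1.symm.trans h2)
  · have := congrArg (fun y : Word A => y.1.length) h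
    simp only [List.length_tail, List.length_cons] at this
    omega
  · have := congrArg (fun y : Word A => y.1.length) h
    simp only [List.length_tail, List.length_cons] at this
    omega
  · exact (List.cons.inj (congrArg Subtype.val h)).1

theorem neighborSet_eq {A : Type u} (x : Word A) :
    (graph A).neighborSet x = Set.range (letter x) := by
  ext y
  rw [SimpleGraph.mem_neighborSet, Set.mem_range]
  constructor
  · rintro (⟨a, h⟩ | ⟨a, h⟩)
    · refine ⟨a, ?_⟩
      have hx : ¬ x.1.head? = some a := by
        intro e
        have hc := y.2
        rw [h, List.isChain_cons] at hc
        exact hc.1 a e rfl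
      rw [letter, dif_neg hx]
      exact Subtype.ext h.symm
    · refine ⟨a, ?_⟩
      rw [letter, dif_pos (by rw [h]; rfl)]
      exact Subtype.ext (congrArg List.tail h)
  · rintro ⟨a, rfl⟩
    unfold letter
    split_ifs with h
    · right
      refine ⟨a, ?_⟩
      obtain ⟨t, ht⟩ := List.head?_eq_some_iff.1 h
      simp [ht]
    · exact Or.inl ⟨a, rfl⟩

/-- Alternating words in two letters. -/
def altList {A : Type u} (a b : A) : ℕ → List A
  | 0 => []
  | n + 1 => (if n % 2 = 0 then a else b) :: altList a b n

theorem altList_isChain {A : Type u} {a b : A} (hab : a ≠ b) :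
    ∀ n, (altList a b n).IsChain (· ≠ ·)
  | 0 => List.isChain_nil
  | 1 => List.isChain_singleton _
  | n + 2 => by
    have h := altList_isChain hab (n + 1)
    rw [altList, altList, List.isChain_cons_cons]
    refine ⟨?_, h⟩
    rcases Nat.mod_two_eq_zero_or_one n with h0 | h0
    · have h1 : (n + 1) % 2 ≠ 0 := by omega
      rw [if_pos h0, if_neg h1]
      exact hab.symm
    · have h1 : (n + 1) % 2 = 0 := by omega
      rw [if_neg (by omega : ¬ n % 2 = 0), if_pos h1]
      exact hab

theorem altList_length {A : Type u} (a b : A) : ∀ n, (altList a b n).length = n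
  | 0 => rfl
  | n + 1 => by rw [altList, List.length_cons, altList_length a b n]

/-- The ray of alternating words. -/
def altRay {A : Type u} {a b : A} (hab : a ≠ b) : TreeRay (graph A) where
  vertex n := ⟨altList a b n, altList_isChain hab n⟩
  adj n := Or.inl ⟨_, rfl⟩
  injective n m h := by
    have := congrArg (fun y : Word A => y.1.length) h
    simpa [altList_length] using this

end RegularTree

/-- Regular trees with a boundary point exist, so that statements about all of them are not
vacuous. -/
theorem PointedRegularTree.nonempty {m : ℕ} (hm : 1 ≤ m) :
    Nonempty (PointedRegularTree.{u} m) :=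
  ⟨{ V := RegularTree.Word (ULift.{u} (Fin (m + 1)))
     T := RegularTree.graph _
     isTree := RegularTree.isTree _
     regular := fun v => by
       rw [RegularTree.neighborSet_eq, ← Set.image_univ,
         Set.ncard_image_of_injective _ (RegularTree.letter_injective v), Set.ncard_univ]
       simp
     ω := Quotient.mk _ (RegularTree.altRay
       (a := ULift.up (0 : Fin (m + 1))) (b := ULift.up (Fin.last m)) fun h => by
         have := congrArg (fun y : ULift.{u} (Fin (m + 1)) => y.down.val) h
         simp at this
         omega) }⟩

open scoped Pointwise

/-! ### Contractions -/

/-! A focal group of totally disconnected type carries a `Contraction`: a character `χ` onto `ℤ`, an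
element `t` with `χ t = 1`, and a compact open subgroup `U` of the kernel that `t` conjugates into a
proper subgroup of itself and whose conjugates exhaust the kernel. The compact open subgroup comes
from the compactness of the identity component. The case `Λ = ℝ` cannot occur, since a connected
group of automorphisms moves every point inside its coset of a compact open subgroup
(`FocalDecomposition.not_isCompact_of_isOpen`). The numerical invariant is the scale `s`, the index
of `t U t⁻¹` in `U`. The modular character equals `s ^ (-χ)`, so `s` is `s_G`.

Obstruction. Along an arrow between focal groups, a contraction on either end yields one on the
other end. If `f : A → B` is copci, then `χ_B ∘ f = c • χ_A` with `c ≥ 1` and `s_A = s_B ^ c`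
(`Contraction.exists_scale_eq_pow`). Hence the scales of commable groups have a common power. That
is an arithmetic condition, equivalent to equality of minimal roots and to commensurability of the
modular ranges.

Construction. The cosets of `U`, with parent map `g U ↦ g t⁻¹ U`, form a regular tree of valency `s
+ 1` with a preferred end. Such trees are unique, so `G` has a copci homomorphism to `FT_s`
(`Contraction.copci_FT`). The subgroup `G^[n]` is cocompact in `G` and has scale `s ^ n`, so it maps
to `FT_{s ^ n}`. All required commations are assembled from these two kinds of arrows, applied to
`G`, to `H` and to `FT_q`. -/

/-- A homomorphism `χ` onto `ℤ` whose kernel is exhausted by the conjugates of a compact open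
subgroup `U`, which an element `t` with `χ t = 1` conjugates into a proper subgroup of itself. -/
structure Contraction (A : Type*) [Group A] [TopologicalSpace A] where
  /-- The character. -/
  χ : A →* Multiplicative ℤ
  /-- The compact open subgroup. -/
  U : Subgroup A
  /-- The contracting element. -/
  t : A
  isOpen : IsOpen (U : Set A)
  isCompact : IsCompact (U : Set A)
  U_le : U ≤ χ.ker
  χ_t : χ t = Multiplicative.ofAdd 1
  conj_mem : ∀ u ∈ U, t * u * t⁻¹ ∈ U
  absorb : ∀ x ∈ χ.ker, ∃ k : ℕ, t ^ k * x * (t ^ k)⁻¹ ∈ U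
  proper : ∃ u ∈ U, t⁻¹ * u * t ∉ U

namespace Contraction

variable {A : Type*} [Group A] [TopologicalSpace A] (C : Contraction A)

/-- The subgroups `t⁻ᵏ U tᵏ`, which increase with `k`. -/
def level (k : ℤ) : Subgroup A := C.U.comap (MulAut.conj (C.t ^ k)).toMonoidHom

theorem mem_level {k : ℤ} {x : A} : x ∈ C.level k ↔ C.t ^ k * x * (C.t ^ k)⁻¹ ∈ C.U := Iff.rfl

@[simp] theorem level_zero : C.level 0 = C.U := by
  ext x; simp [mem_level]

theorem conj_mem_level {k j : ℤ} {x : A} :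
    C.t ^ j * x * (C.t ^ j)⁻¹ ∈ C.level k ↔ x ∈ C.level (k + j) := by
  rw [mem_level, mem_level, zpow_add]
  simp only [mul_inv_rev, mul_assoc]

theorem level_mono : Monotone C.level := by
  refine monotone_int_of_le_succ fun k x hx => ?_
  rw [mem_level, add_comm, zpow_add, zpow_one]
  have := C.conj_mem _ (C.mem_level.1 hx)
  simpa only [mul_inv_rev, mul_assoc] using this

theorem χ_t_zpow (k : ℤ) : C.χ (C.t ^ k) = Multiplicative.ofAdd k := by
  rw [map_zpow, C.χ_t, ← ofAdd_zsmul]; simp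

theorem level_le_ker (k : ℤ) : C.level k ≤ C.χ.ker := by
  intro x hx
  have := C.U_le (C.mem_level.1 hx)
  rw [MonoidHom.mem_ker] at this ⊢
  simpa using this

theorem exists_mem_level {x : A} (hx : x ∈ C.χ.ker) : ∃ k : ℕ, x ∈ C.level k := by
  obtain ⟨k, hk⟩ := C.absorb x hx
  exact ⟨k, by rw [mem_level, zpow_natCast]; exact hk⟩

/-- Every element is a product of an element of the kernel and a power of `t`; this splitting is
used throughout. -/
theorem mul_zpow_mem_ker (x : A) : x * (C.t ^ (C.χ x).toAdd)⁻¹ ∈ C.χ.ker := by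
  rw [MonoidHom.mem_ker, map_mul, map_inv, χ_t_zpow]; simp

theorem coe_level (k : ℤ) :
    (C.level k : Set A) = (fun x => (C.t ^ k)⁻¹ * x * C.t ^ k) '' (C.U : Set A) := by
  ext x
  simp only [SetLike.mem_coe, Set.mem_image, mem_level]
  constructor
  · intro h
    exact ⟨_, h, by group⟩
  · rintro ⟨y, hy, rfl⟩
    have : C.t ^ k * ((C.t ^ k)⁻¹ * y * C.t ^ k) * (C.t ^ k)⁻¹ = y := by group
    rwa [this]

section Topological

variable [IsTopologicalGroup A]

theorem isOpen_level (k : ℤ) : IsOpen (C.level k : Set A) :=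
  C.isOpen.preimage (by change Continuous fun x => C.t ^ k * x * (C.t ^ k)⁻¹; fun_prop)

theorem isCompact_level (k : ℤ) : IsCompact (C.level k : Set A) := by
  rw [coe_level]
  exact C.isCompact.image (by fun_prop)

theorem isOpen_coe_ker : IsOpen (C.χ.ker : Set A) :=
  Subgroup.isOpen_mono C.U_le C.isOpen

theorem continuous_χ : Continuous C.χ := by
  refine continuous_of_continuousAt_one C.χ ?_
  rw [ContinuousAt, map_one, nhds_discrete (Multiplicative ℤ), Filter.tendsto_pure]
  exact C.isOpen_coe_ker.mem_nhds (one_mem _)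

/-- The levels form an increasing open cover of the kernel, so compactness selects one of them. -/
theorem subset_level {K : Set A} (hK : IsCompact K) (hKer : K ⊆ C.χ.ker) :
    ∃ k : ℕ, K ⊆ C.level k := by
  have hcov : K ⊆ ⋃ k : ℕ, (C.level k : Set A) := fun x hx =>
    Set.mem_iUnion.2 (C.exists_mem_level (hKer hx))
  obtain ⟨k, hk⟩ := hK.elim_directed_cover (fun k : ℕ => (C.level k : Set A)) (fun k => C.isOpen_level k) hcov
    (Monotone.directed_le fun i j hij => C.level_mono (by exact_mod_cast hij))
  exact ⟨k, hk⟩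

theorem locallyCompactSpace (C : Contraction A) : LocallyCompactSpace A :=
  IsCompact.locallyCompactSpace_of_mem_nhds_of_group C.isCompact (C.isOpen.mem_nhds (one_mem _))

end Topological

/-- The index of `t U t⁻¹` in `U`. -/
noncomputable def scale : ℕ := (C.level (-1)).relIndex (C.level 0)

theorem level_comap (k j : ℤ) :
    (C.level k).comap (MulAut.conj (C.t ^ j)).toMonoidHom = C.level (k + j) := by
  ext x; exact C.conj_mem_level

theorem map_level (k j : ℤ) :
    (C.level (k + j)).map (MulAut.conj (C.t ^ j)).toMonoidHom = C.level k := by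
  rw [← level_comap, Subgroup.map_comap_eq_self_of_surjective]
  exact (MulAut.conj (C.t ^ j)).surjective

/-- Conjugation by `t ^ (k + 1)` carries this pair of consecutive levels to the pair defining the
scale. -/
theorem relIndex_level_succ (k : ℤ) : (C.level k).relIndex (C.level (k + 1)) = C.scale := by
  have h1 : C.level k = C.level (-1 + (k + 1)) := by congr 1; ring
  have h2 : C.level (k + 1) = C.level (0 + (k + 1)) := by congr 1; ring
  rw [h1, ← C.level_comap (-1), Subgroup.relIndex_comap, h2, C.map_level, scale]

theorem relIndex_level (k : ℤ) (n : ℕ) :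
    (C.level k).relIndex (C.level (k + n)) = C.scale ^ n := by
  induction n with
  | zero => simp
  | succ n ih =>
    rw [pow_succ, ← ih, ← C.relIndex_level_succ (k + n), Nat.cast_succ, ← add_assoc,
      Subgroup.relIndex_mul_relIndex _ _ _ (C.level_mono (by omega)) (C.level_mono (by omega))]

theorem scale_ne_zero [IsTopologicalGroup A] : C.scale ≠ 0 := by
  have hc : CompactSpace (C.level 0) := isCompact_iff_compactSpace.1 (C.isCompact_level 0)
  have ho : IsOpen ((C.level (-1)).subgroupOf (C.level 0) : Set (C.level 0)) :=
    (C.isOpen_level (-1)).preimage continuous_subtype_val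
  have := Subgroup.quotient_finite_of_isOpen _ ho
  have := Subgroup.finiteIndex_of_finite_quotient (H := (C.level (-1)).subgroupOf (C.level 0))
  exact this.index_ne_zero

theorem two_le_scale [IsTopologicalGroup A] : 2 ≤ C.scale := by
  have h0 := C.scale_ne_zero
  have h1 : C.scale ≠ 1 := by
    intro h
    rw [scale, Subgroup.relIndex_eq_one] at h
    obtain ⟨u, hu, hn⟩ := C.proper
    apply hn
    have := h (by simpa using hu)
    simpa [mem_level] using this
  omega

end Contraction

/-! ### Contractions and focal decompositions -/

namespace Contraction

section

variable {A : Type*} [Group A] [TopologicalSpace A] (C : Contraction A)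

/-- The action of `ℤ` on the kernel of the character by conjugation. -/
noncomputable def action : Multiplicative ℤ →* MulAut C.χ.ker :=
  (MulAut.conjNormal (H := C.χ.ker)).comp (zpowersHom A C.t)

theorem coe_action (k : Multiplicative ℤ) (x : C.χ.ker) :
    (C.action k x : A) = C.t ^ k.toAdd * x * (C.t ^ k.toAdd)⁻¹ := rfl

theorem coe_action_iterate (k : ℤ) (n : ℕ) (x : C.χ.ker) :
    (((C.action (Multiplicative.ofAdd k))^[n] x : C.χ.ker) : A) =
      C.t ^ (k * n) * x * (C.t ^ (k * n))⁻¹ := by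
  induction n with
  | zero => simp
  | succ n ih =>
    rw [Function.iterate_succ_apply', coe_action, ih, toAdd_ofAdd, Nat.cast_succ, mul_add, mul_one,
      add_comm, zpow_add]
    simp only [mul_inv_rev, mul_assoc]

/-- The group as a semidirect product. -/
noncomputable def semidirectEquiv : A ≃* (C.χ.ker ⋊[C.action] Multiplicative ℤ) where
  toFun x := ⟨⟨_, C.mul_zpow_mem_ker x⟩, C.χ x⟩
  invFun y := y.left * C.t ^ y.right.toAdd
  left_inv x := by simp
  right_inv y := by
    have : C.χ y.left = 1 := y.left.2
    have h : C.χ (y.left * C.t ^ y.right.toAdd) = y.right := by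
      rw [map_mul, this, χ_t_zpow]; simp
    refine SemidirectProduct.ext (Subtype.ext ?_) h
    simp [h]
  map_mul' x y := by
    refine SemidirectProduct.ext (Subtype.ext ?_) (map_mul _ _ _)
    rw [SemidirectProduct.mul_left, Subgroup.coe_mul, coe_action]
    simp [zpow_add, mul_assoc]

/-- A compact kernel would lie in one level, making the next level equal to it, against `2 ≤ scale`.
-/
theorem not_compactSpace_ker [IsTopologicalGroup A] : ¬ CompactSpace C.χ.ker := by
  intro h
  obtain ⟨k, hk⟩ := C.subset_level (isCompact_iff_compactSpace.2 h) subset_rfl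
  have h1 : (C.level k).relIndex (C.level (k + 1)) = 1 :=
    Subgroup.relIndex_eq_one.2 fun x hx => hk (C.level_le_ker _ hx)
  rw [C.relIndex_level_succ] at h1
  have := C.two_le_scale
  omega

theorem isCompacting_action [IsTopologicalGroup A] {k : ℤ} (hk : 0 < k) :
    IsCompacting (C.action (Multiplicative.ofAdd k)) := by
  refine ⟨(↑) ⁻¹' (C.U : Set A), ?_, fun K hK => ?_⟩
  · exact (C.χ.ker.isClosed_of_isOpen C.isOpen_coe_ker).isClosedEmbedding_subtypeVal
      |>.isCompact_preimage C.isCompact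
  · obtain ⟨j, hj⟩ := C.subset_level (hK.image continuous_subtype_val) (by
      rintro _ ⟨x, -, rfl⟩; exact x.2)
    -- Each iterate lowers the level by `k ≥ 1`, so `j` iterates bring level `j` into `U`; the extra
    -- one keeps the exponent positive.
    refine ⟨j + 1, by omega, ?_⟩
    rintro _ ⟨x, hx, rfl⟩
    rw [Set.mem_preimage, coe_action_iterate, ← C.level_zero, SetLike.mem_coe, C.conj_mem_level]
    refine C.level_mono ?_ (hj ⟨x, hx, rfl⟩)
    push_cast
    nlinarith

/-- The group as a topological semidirect product. -/
noncomputable def semidirectHomeo [IsTopologicalGroup A] :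
    A ≃ₜ* (C.χ.ker ⋊[C.action] Multiplicative ℤ) where
  __ := C.semidirectEquiv
  continuous_toFun := by
    refine continuous_induced_rng.2 (Continuous.prodMk ?_ C.continuous_χ)
    refine Continuous.subtype_mk ?_ _
    have : Continuous fun k : Multiplicative ℤ => C.t ^ k.toAdd := continuous_of_discreteTopology
    exact continuous_id.mul (this.comp C.continuous_χ).inv
  continuous_invFun := by
    have : Continuous fun k : Multiplicative ℤ => C.t ^ k.toAdd := continuous_of_discreteTopology
    have h : Continuous (SemidirectProduct.equivProd :
      (C.χ.ker ⋊[C.action] Multiplicative ℤ) ≃ _) := continuous_induced_dom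
    exact (continuous_subtype_val.comp (continuous_fst.comp h)).mul
      (this.comp (continuous_snd.comp h))

end

/-! ### Focal decomposition of a group with a contraction, and its subgroups `G^[n]` -/

variable {G : TopGroup.{u}} (C : Contraction G)

/-- The focal decomposition given by a contraction. -/
noncomputable def focalDecomposition [T2Space G] : FocalDecomposition ℤ G where
  N := TopGroup.of C.χ.ker
  isLCGroup := by
    have := C.locallyCompactSpace
    have hc : IsClosed (C.χ.ker : Set G) := C.χ.ker.isClosed_of_isOpen C.isOpen_coe_ker
    exact ⟨hc.isClosedEmbedding_subtypeVal.locallyCompactSpace, inferInstanceAs (T2Space C.χ.ker)⟩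
  noncompact := C.not_compactSpace_ker
  φ := C.action
  continuous_action := by
    have : Continuous fun k : Multiplicative ℤ => C.t ^ k.toAdd := continuous_of_discreteTopology
    refine continuous_induced_rng.2 ?_
    exact ((this.comp continuous_fst).mul (continuous_subtype_val.comp continuous_snd)).mul
      (this.comp continuous_fst).inv
  compacting := fun _ => C.isCompacting_action
  iso := C.semidirectHomeo

theorem mem_powSubgroup [T2Space G] {n : ℕ} {x : G} :
    x ∈ C.focalDecomposition.powSubgroup n ↔ (n : ℤ) ∣ (C.χ x).toAdd := by
  change C.χ x ∈ Subgroup.zpowers _ ↔ _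
  rw [Subgroup.mem_zpowers_iff]
  constructor
  · rintro ⟨k, hk⟩
    rw [← hk, ← ofAdd_zsmul, toAdd_ofAdd]
    simp
  · rintro ⟨k, hk⟩
    refine ⟨k, ?_⟩
    rw [← ofAdd_zsmul, smul_eq_mul, mul_comm, ← hk, ofAdd_toAdd]

theorem isOpen_powSubgroup [T2Space G] (n : ℕ) :
    IsOpen (C.focalDecomposition.powSubgroup n : Set G) :=
  Subgroup.isOpen_mono (fun x hx => by
    rw [mem_powSubgroup, MonoidHom.mem_ker.1 hx]; simp) C.isOpen_coe_ker

theorem isClosedEmbedding_powSubgroup [T2Space G] (n : ℕ) :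
    Topology.IsClosedEmbedding ((↑) : C.focalDecomposition.powSubgroup n → G) :=
  ((C.focalDecomposition.powSubgroup n).isClosed_of_isOpen
    (C.isOpen_powSubgroup n)).isClosedEmbedding_subtypeVal

theorem isFocal (C : Contraction G) [T2Space G] : IsFocal G :=
  ⟨⟨C.locallyCompactSpace, inferInstance⟩, Or.inl ⟨C.focalDecomposition⟩⟩

/-- The restriction of a contraction to the subgroup where the character is divisible by `n`. -/
noncomputable def pow [T2Space G] {n : ℕ} (hn : 1 ≤ n) :
    Contraction (C.focalDecomposition.powSubgroup n) where
  χ :=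
    -- The integer division is exact, because `n` divides the character on this subgroup; it makes
    -- `t ^ n` have value `1`.
    { toFun := fun x => Multiplicative.ofAdd ((C.χ x).toAdd / n)
      map_one' := by simp
      map_mul' := fun x y => by
        rw [← ofAdd_add, Subgroup.coe_mul, map_mul, toAdd_mul,
          Int.add_ediv_of_dvd_left (C.mem_powSubgroup.1 x.2)] }
  U := C.U.subgroupOf _
  t := ⟨C.t ^ n, by
    rw [mem_powSubgroup, ← zpow_natCast, χ_t_zpow]; simp⟩
  isOpen := C.isOpen.preimage continuous_subtype_val
  isCompact := (C.isClosedEmbedding_powSubgroup n).isCompact_preimage C.isCompact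
  U_le := fun x hx => by
    have : C.χ x = 1 := C.U_le hx
    simp [MonoidHom.mem_ker, this]
  χ_t := by
    have : (n : ℤ) ≠ 0 := by omega
    simp [← zpow_natCast, χ_t_zpow, Int.ediv_self this]
  conj_mem := fun u hu => by
    rw [Subgroup.mem_subgroupOf, ← C.level_zero] at *
    have := C.conj_mem_level (k := 0) (j := n) (x := u)
    rw [zpow_natCast] at this
    exact this.2 (C.level_mono (by omega) hu)
  absorb := fun x hx => by
    have hx' : (x : G) ∈ C.χ.ker := by
      have h1 : (C.χ x).toAdd / (n : ℤ) = 0 := hx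
      have h2 := Int.ediv_mul_cancel (C.mem_powSubgroup.1 x.2)
      rw [h1, zero_mul] at h2
      exact h2.symm
    obtain ⟨k, hk⟩ := C.exists_mem_level hx'
    refine ⟨k, ?_⟩
    rw [Subgroup.mem_subgroupOf, ← C.level_zero]
    have := C.conj_mem_level (k := 0) (j := (n * k : ℕ)) (x := x)
    rw [zpow_natCast, pow_mul] at this
    refine this.2 (C.level_mono ?_ hk)
    push_cast
    nlinarith
  proper := by
    obtain ⟨u, hu, hn'⟩ := C.proper
    refine ⟨⟨u, ?_⟩, hu, ?_⟩
    · rw [mem_powSubgroup, C.U_le hu]; simp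
    · intro h
      rw [Subgroup.mem_subgroupOf, ← C.level_zero] at h
      have := C.conj_mem_level (k := 0) (j := -n) (x := u)
      rw [zpow_neg, zpow_natCast, inv_inv] at this
      have := C.level_mono (show (0 : ℤ) + -n ≤ -1 by omega) (this.1 h)
      apply hn'
      simpa [mem_level] using this

/-- Conjugation by `t ^ n` descends `n` levels, each of index `scale` in the next. -/
theorem scale_pow [T2Space G] {n : ℕ} (hn : 1 ≤ n) : (C.pow hn).scale = C.scale ^ n := by
  have hle : C.level 0 ≤ C.focalDecomposition.powSubgroup n := fun x hx => by
    rw [mem_powSubgroup, C.level_le_ker _ hx]; simp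
  have h := C.relIndex_level (-n) n
  rw [neg_add_cancel] at h
  rw [← h, scale, ← Subgroup.relIndex_subgroupOf hle]
  congr 1
  · ext x
    rw [mem_level, Subgroup.mem_subgroupOf, mem_level]
    simp [pow, Subgroup.mem_subgroupOf]
  · ext x
    rw [level_zero, level_zero]
    rfl

end Contraction

/-! ### Copci homomorphisms -/

theorem Subgroup.compactSpace_quotient_of_isCompact {B : Type*} [Group B] [TopologicalSpace B]
    {H : Subgroup B} {K : Set B} (hK : IsCompact K) (h : ∀ b, ∃ k ∈ K, k⁻¹ * b ∈ H) :
    CompactSpace (B ⧸ H) := by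
  refine ⟨?_⟩
  have : (Set.univ : Set (B ⧸ H)) = (fun b : B => (b : B ⧸ H)) '' K := by
    refine (Set.eq_univ_of_forall fun q => ?_).symm
    induction q using QuotientGroup.induction_on with
    | H b =>
      obtain ⟨k, hk, hb⟩ := h b
      exact ⟨k, hk, QuotientGroup.eq.2 hb⟩
  rw [this]
  exact hK.image continuous_quotient_mk'

/-- Finitely many images of interiors of compact neighbourhoods cover the quotient. This turns
cocompactness into a covering by a compact set times the subgroup. -/
theorem Subgroup.exists_isCompact_of_compactSpace_quotient {B : Type*} [Group B]
    [TopologicalSpace B] [IsTopologicalGroup B] [LocallyCompactSpace B] (H : Subgroup B)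
    [CompactSpace (B ⧸ H)] : ∃ K : Set B, IsCompact K ∧ ∀ b, ∃ k ∈ K, k⁻¹ * b ∈ H := by
  choose K hKc hK using fun b : B => exists_compact_mem_nhds b
  let π : B → B ⧸ H := fun b => b
  obtain ⟨s, hs⟩ := isCompact_univ.elim_finite_subcover (fun b => π '' interior (K b))
    (fun b => QuotientGroup.isOpenMap_coe _ isOpen_interior) (by
      intro q _
      induction q using QuotientGroup.induction_on with
      | H b => exact Set.mem_iUnion.2 ⟨b, b, mem_interior_iff_mem_nhds.2 (hK b), rfl⟩)
  refine ⟨⋃ b ∈ s, K b, s.isCompact_biUnion fun b _ => hKc b, fun b => ?_⟩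
  obtain ⟨c, hc, k, hk, hkb⟩ := Set.mem_iUnion₂.1 (hs (Set.mem_univ (π b)))
  exact ⟨k, Set.mem_iUnion₂.2 ⟨c, hc, interior_subset hk⟩, QuotientGroup.eq.1 hkb⟩

/-- If `C` and `D` are compact sets for the two images, then `D * g(C)` is one for the image of the
composite. -/
theorem Copci.trans {G H K : TopGroup.{u}} [LocallyCompactSpace H] [LocallyCompactSpace K]
    (hGH : Copci G H) (hHK : Copci H K) : Copci G K := by
  obtain ⟨f, hf, hfc⟩ := hGH
  obtain ⟨g, hg, hgc⟩ := hHK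
  obtain ⟨C, hC, hC'⟩ := f.range.exists_isCompact_of_compactSpace_quotient
  obtain ⟨D, hD, hD'⟩ := g.range.exists_isCompact_of_compactSpace_quotient
  refine ⟨g.comp f, hg.comp hf,
    Subgroup.compactSpace_quotient_of_isCompact (hD.mul (hC.image hg.continuous)) fun b => ?_⟩
  obtain ⟨d, hd, y, hy⟩ := hD' b
  obtain ⟨c, hc, x, hx⟩ := hC' y
  refine ⟨d * g c, Set.mul_mem_mul hd ⟨c, hc, rfl⟩, x, ?_⟩
  rw [MonoidHom.comp_apply, hx, map_mul, hy, map_inv, mul_inv_rev, mul_assoc]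

/-- A continuous homomorphism pulling back a compact open subgroup `W` to a compact set, and whose
image together with `W` covers the target, is proper with cocompact image. -/
theorem Copci.of_isCompact {G H : TopGroup.{u}} [T2Space H] (f : G →* H) (hf : Continuous f)
    (W : Subgroup H) (hWo : IsOpen (W : Set H)) (hWc : IsCompact (W : Set H))
    (hfW : IsCompact (f ⁻¹' W)) (hcov : ∀ h, ∃ g, (f g)⁻¹ * h ∈ W) : Copci G H := by
  have : LocallyCompactSpace H :=
    hWc.locallyCompactSpace_of_mem_nhds_of_group (hWo.mem_nhds (one_mem _))
  refine ⟨f, isProperMap_iff_isCompact_preimage.2 ⟨hf, fun K hK => ?_⟩,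
    Subgroup.compactSpace_quotient_of_isCompact hWc fun b => ?_⟩
  -- A compact set meets finitely many translates `f g • W`, and their preimages are translates of
  -- the compact set `f⁻¹(W)`.
  · obtain ⟨s, hs⟩ := hK.elim_finite_subcover (fun g : G => (fun h => (f g)⁻¹ * h) ⁻¹' (W : Set H))
      (fun g => hWo.preimage (by fun_prop)) fun h _ => Set.mem_iUnion.2 (hcov h)
    have hcomp : IsCompact (⋃ g ∈ s, (fun x => g * x) '' (f ⁻¹' W)) :=
      s.isCompact_biUnion fun g _ => hfW.image (by fun_prop)
    refine hcomp.of_isClosed_subset (hK.isClosed.preimage hf) fun x hx => ?_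
    obtain ⟨g, hg, hgx⟩ := Set.mem_iUnion₂.1 (hs hx)
    refine Set.mem_iUnion₂.2 ⟨g, hg, g⁻¹ * x, ?_, by simp⟩
    simpa using hgx
  -- The inverse exchanges sides: the hypothesis covers by `f(G) W`, while cocompactness needs `W
  -- f(G)`.
  · obtain ⟨g, hg⟩ := hcov b⁻¹
    refine ⟨((f g)⁻¹ * b⁻¹)⁻¹, inv_mem hg, g⁻¹, ?_⟩
    rw [map_inv]; group

theorem Contraction.exists_pow_inv_mul_mem {G : TopGroup.{u}} [T2Space G] (C : Contraction G)
    {n : ℕ} (hn : 1 ≤ n) (b : G) : ∃ k : ℕ, k < n ∧ (C.t ^ k)⁻¹ * b ∈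
      C.focalDecomposition.powSubgroup n := by
  have hn' : (n : ℤ) ≠ 0 := by omega
  have h0 := Int.emod_nonneg (C.χ b).toAdd hn'
  have h1 := Int.emod_lt_of_pos (C.χ b).toAdd (by omega : (0 : ℤ) < n)
  refine ⟨((C.χ b).toAdd % n).toNat, by omega, ?_⟩
  rw [mem_powSubgroup, map_mul, map_inv, ← zpow_natCast, χ_t_zpow,
    Int.toNat_of_nonneg h0, toAdd_mul, toAdd_inv, toAdd_ofAdd]
  exact ⟨(C.χ b).toAdd / n, by have := Int.emod_add_mul_ediv (C.χ b).toAdd n; omega⟩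

theorem Contraction.copci_subtype {G : TopGroup.{u}} [T2Space G] (C : Contraction G) {n : ℕ}
    (hn : 1 ≤ n) : Copci (TopGroup.of (C.focalDecomposition.powSubgroup n)) G := by
  refine ⟨(C.focalDecomposition.powSubgroup n).subtype,
    (C.isClosedEmbedding_powSubgroup n).isProperMap, ?_⟩
  refine Subgroup.compactSpace_quotient_of_isCompact (K := (fun k : ℕ => C.t ^ k) '' Set.Iio n)
    ((Set.finite_Iio n).image _).isCompact fun b => ?_
  obtain ⟨k, hk, hb⟩ := C.exists_pow_inv_mul_mem hn b
  exact ⟨_, ⟨k, hk, rfl⟩, by rwa [Subgroup.range_subtype]⟩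

theorem Contraction.copci_powSubgroup {G : TopGroup.{u}} [T2Space G] (C : Contraction G) {n m : ℕ}
    (hn : 1 ≤ n) (hm : m ∣ n) : Copci (TopGroup.of (C.focalDecomposition.powSubgroup n))
      (TopGroup.of (C.focalDecomposition.powSubgroup m)) := by
  have hle : C.focalDecomposition.powSubgroup n ≤ C.focalDecomposition.powSubgroup m := fun x hx =>
    C.mem_powSubgroup.2 ((Int.natCast_dvd_natCast.2 hm).trans (C.mem_powSubgroup.1 hx))
  refine ⟨Subgroup.inclusion hle, isProperMap_of_comp_of_t2 (continuous_subtype_val.subtype_mk _)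
    continuous_subtype_val (C.isClosedEmbedding_powSubgroup n).isProperMap, ?_⟩
  refine Subgroup.compactSpace_quotient_of_isCompact
    (K := Subtype.val ⁻¹' ((fun k : ℕ => C.t ^ k) '' Set.Iio n))
    (((Set.finite_Iio n).image _).preimage Subtype.val_injective.injOn).isCompact fun b => ?_
  obtain ⟨k, hk, hb⟩ := C.exists_pow_inv_mul_mem hn b.1
  have hk' : C.t ^ k ∈ C.focalDecomposition.powSubgroup m := by
    simpa using mul_mem b.2 (inv_mem (hle hb))
  exact ⟨⟨_, hk'⟩, ⟨k, hk, rfl⟩, ⟨_, hb⟩, rfl⟩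

/-! ### Compacting automorphisms -/

theorem MulAut.zpow_add_apply {N : Type*} [Group N] (α : MulAut N) (i j : ℤ) (x : N) :
    (α ^ i) ((α ^ j) x) = (α ^ (i + j)) x := by
  rw [zpow_add]; rfl

theorem MulAut.iterate_apply {N : Type*} [Group N] (α : MulAut N) (k : ℕ) (x : N) :
    α^[k] x = (α ^ (k : ℤ)) x := by
  induction k with
  | zero => simp
  | succ k ih =>
    rw [Function.iterate_succ_apply', ih, Nat.cast_succ, add_comm, zpow_add, zpow_one]; rfl

/-- A compacting automorphism admits a forward invariant absorbing compact set. -/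
theorem IsCompacting.exists_invariant {N : Type*} [Group N] [TopologicalSpace N]
    {α : MulAut N} (hα : ∀ k : ℤ, Continuous (α ^ k))
    (h : IsCompacting α) : ∃ Ω : Set N, IsCompact Ω ∧ (∀ x ∈ Ω, ∀ k : ℕ, (α ^ (k : ℤ)) x ∈ Ω) ∧
      ∀ K, IsCompact K → ∃ k : ℕ, ∀ x ∈ K, (α ^ (k : ℤ)) x ∈ Ω := by
  obtain ⟨Ω, hΩ, habs⟩ := h
  obtain ⟨n, hn, hnΩ⟩ := habs Ω hΩ
  have hiter : ∀ y ∈ Ω, (α ^ (n : ℤ)) y ∈ Ω := fun y hy =>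
    hnΩ ⟨y, hy, MulAut.iterate_apply α n y⟩
  -- Since `α ^ n` maps `Ω` into itself, `α` shifts the pieces `α ^ i (Ω)`, `i < n`, and sends the
  -- last one back into the first.
  have hstep : ∀ x ∈ ⋃ i ∈ Finset.range n, (α ^ (i : ℤ)) '' Ω,
      α x ∈ ⋃ i ∈ Finset.range n, (α ^ (i : ℤ)) '' Ω := by
    intro x hx
    obtain ⟨i, hi, y, hy, rfl⟩ := Set.mem_iUnion₂.1 hx
    rw [Finset.mem_range] at hi
    have h1 : α ((α ^ (i : ℤ)) y) = (α ^ ((i + 1 : ℕ) : ℤ)) y := by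
      rw [Nat.cast_succ, add_comm, zpow_add, zpow_one]; rfl
    rw [h1]
    rcases Nat.lt_or_ge (i + 1) n with h2 | h2
    · exact Set.mem_iUnion₂.2 ⟨i + 1, Finset.mem_range.2 h2, y, hy, rfl⟩
    · have h3 : i + 1 = n := by omega
      rw [h3]
      exact Set.mem_iUnion₂.2 ⟨0, Finset.mem_range.2 (by omega), _, hiter y hy, by simp⟩
  refine ⟨⋃ i ∈ Finset.range n, (α ^ (i : ℤ)) '' Ω,
    (Finset.range n).isCompact_biUnion fun i _ => hΩ.image (hα i), fun x hx k => ?_, fun K hK => ?_⟩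
  · rw [← MulAut.iterate_apply]
    induction k with
    | zero => exact hx
    | succ k ih => rw [Function.iterate_succ_apply']; exact hstep _ ih
  · obtain ⟨k, -, hk⟩ := habs K hK
    refine ⟨k, fun x hx => Set.mem_iUnion₂.2 ⟨0, Finset.mem_range.2 (by omega), _,
      hk ⟨x, hx, MulAut.iterate_apply α k x⟩, by simp⟩⟩

section Compacting

variable {N : Type*} [Group N] [TopologicalSpace N] [IsTopologicalGroup N]

/-- The left stabilizer of a compact open set is open. -/
theorem IsCompact.isOpen_stabilizer {S : Set N} (hc : IsCompact S) (ho : IsOpen S) :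
    IsOpen (MulAction.stabilizer N S : Set N) := by
  obtain ⟨W, hW, hWS⟩ := compact_open_separated_mul_left hc ho subset_rfl
  refine Subgroup.isOpen_of_mem_nhds _ (g := 1)
    (Filter.mem_of_superset (Filter.inter_mem hW (inv_mem_nhds_one N hW)) ?_)
  rintro x ⟨hx, hx'⟩
  rw [SetLike.mem_coe, MulAction.mem_stabilizer_iff]
  refine Set.Subset.antisymm ?_ ?_
  · rintro _ ⟨y, hy, rfl⟩
    exact hWS (Set.mul_mem_mul hx hy)
  · intro y hy
    rw [Set.mem_smul_set_iff_inv_smul_mem]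
    exact hWS (Set.mul_mem_mul hx' hy)

/-- In a locally compact group with a compact open subgroup, any compact subgroup is contained in
a compact open one. -/
theorem Subgroup.exists_isCompact_isOpen_ge {V Q : Subgroup N} (hVo : IsOpen (V : Set N))
    (hVc : IsCompact (V : Set N)) (hQ : IsCompact (Q : Set N)) :
    ∃ U : Subgroup N, IsOpen (U : Set N) ∧ IsCompact (U : Set N) ∧ Q ≤ U := by
  -- The required subgroup is the left stabilizer of the compact open set `Q V`. It contains `Q`,
  -- and lies in `Q V` because `1 ∈ Q V`.
  have hc : IsCompact ((Q : Set N) * (V : Set N)) := hQ.mul hVc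
  have ho := hc.isOpen_stabilizer hVo.mul_left
  refine ⟨_, ho, hc.of_isClosed_subset (Subgroup.isClosed_of_isOpen _ ho) fun x hx => ?_,
    fun q hq => ?_⟩
  · rw [SetLike.mem_coe, MulAction.mem_stabilizer_iff] at hx
    rw [← hx]
    exact ⟨1, ⟨1, Q.one_mem, 1, V.one_mem, one_mul _⟩, mul_one x⟩
  · rw [MulAction.mem_stabilizer_iff, ← smul_mul_assoc]
    congr 1
    exact smul_coe_set hq

/-- A compacting automorphism of a group with a compact open subgroup contracts some compact open
subgroup into itself, and this subgroup is absorbing. -/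
theorem IsCompacting.exists_subgroup [T2Space N] {α : MulAut N} (hα : ∀ k : ℤ, Continuous (α ^ k))
    (h : IsCompacting α) {V : Subgroup N} (hVo : IsOpen (V : Set N))
    (hVc : IsCompact (V : Set N)) :
    ∃ U : Subgroup N, IsOpen (U : Set N) ∧ IsCompact (U : Set N) ∧ (∀ u ∈ U, α u ∈ U) ∧
      ∀ x, ∃ k : ℕ, (α ^ (k : ℤ)) x ∈ U := by
  obtain ⟨Ω, hΩ, hinv, habs⟩ := h.exists_invariant hα
  -- A compact backward-invariant set `S` lies in `Ω`: write a point as `α ^ m` of its `m`-th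
  -- backward iterate, with `m` large enough for all of `S`.
  have key : ∀ S : Set N, IsCompact S → (∀ x ∈ S, ∀ k : ℕ, (α ^ (-k : ℤ)) x ∈ S) →
      ∀ x ∈ S, ∀ k : ℕ, (α ^ (-k : ℤ)) x ∈ Ω := by
    intro S hS hSinv x hx k
    obtain ⟨m, hm⟩ := habs S hS
    have := hm _ (hSinv x hx (m + k))
    rw [MulAut.zpow_add_apply] at this
    convert! this using 3
    push_cast; ring
  -- The points whose whole backward orbit stays in `Ω` form the largest compact backward-invariant
  -- set. Products and inverses of such sets are again compact and backward invariant, so by `key`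
  -- it is a subgroup.
  set Q₀ : Set N := {x | ∀ k : ℕ, (α ^ (-k : ℤ)) x ∈ Ω} with hQ₀
  have hQc : IsCompact Q₀ := by
    refine hΩ.of_isClosed_subset ?_ fun x hx => by simpa using hx 0
    rw [hQ₀, Set.ofPred_forall]
    exact isClosed_iInter fun k => hΩ.isClosed.preimage (hα _)
  have hQinv : ∀ x ∈ Q₀, ∀ k : ℕ, (α ^ (-k : ℤ)) x ∈ Q₀ := fun x hx k j => by
    rw [MulAut.zpow_add_apply]
    have := hx (j + k)
    rwa [Nat.cast_add, neg_add] at this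
  let Q : Subgroup N :=
    { carrier := Q₀
      mul_mem' := fun {a b} ha hb => key (Q₀ * Q₀) (hQc.mul hQc) (by
        rintro _ ⟨x, hx, y, hy, rfl⟩ k
        exact ⟨_, hQinv x hx k, _, hQinv y hy k, (map_mul _ _ _).symm⟩) _ ⟨a, ha, b, hb, rfl⟩
      one_mem' := key {1} isCompact_singleton (by rintro _ rfl k; simp) _ rfl
      inv_mem' := fun {a} ha => key (Q₀⁻¹) hQc.inv (by
        intro x hx k
        rw [Set.mem_inv, ← map_inv]
        exact hQinv _ hx k) _ (by simpa using ha) }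
  obtain ⟨U, hUo, hUc, hQU⟩ := Subgroup.exists_isCompact_isOpen_ge (Q := Q) hVo hVc hQc
  -- The decreasing compact sets `α ^ k (Ω)` have intersection inside `Q`, hence inside the open set
  -- `U`, so one of them already lies in `U`.
  obtain ⟨k₀, hk₀⟩ : ∃ k : ℕ, (α ^ (k : ℤ)) '' Ω ⊆ U := by
    refine exists_subset_nhds_of_isCompact (V := fun k : ℕ => (α ^ (k : ℤ)) '' Ω)
      (directed_of_isDirected_le fun i j hij => ?_) (fun k => hΩ.image (hα _)) fun x hx => ?_
    · rintro _ ⟨x, hx, rfl⟩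
      refine ⟨_, hinv x hx (j - i), ?_⟩
      rw [MulAut.zpow_add_apply]
      congr 2
      omega
    · refine hUo.mem_nhds (hQU fun k => ?_)
      obtain ⟨y, hy, rfl⟩ := Set.mem_iInter.1 hx k
      rw [MulAut.zpow_add_apply]
      simpa using hy
  have hk₀' : ∀ x ∈ Ω, ∀ m : ℤ, k₀ ≤ m → (α ^ m) x ∈ U := fun x hx m hm => by
    have := hk₀ ⟨_, hinv x hx (m - k₀).toNat, rfl⟩
    rw [MulAut.zpow_add_apply] at this
    convert! this using 3
    omega
  obtain ⟨j, hj⟩ := habs U hUc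
  obtain ⟨m, hm1, hm⟩ : ∃ m : ℕ, 1 ≤ m ∧ ∀ x ∈ U, (α ^ (m : ℤ)) x ∈ U := by
    -- The first `j` iterates bring `U` into `Ω`, and any `k₀` or more bring `Ω` back into `U`; the
    -- `1` ensures `m ≥ 1`.
    refine ⟨k₀ + 1 + j, by omega, fun x hx => ?_⟩
    have := hk₀' _ (hj x hx) (k₀ + 1) (by omega)
    rw [MulAut.zpow_add_apply] at this
    exact_mod_cast this
  -- This is the intersection of `α ^ i (U)` for `i < m`. It is mapped into itself by `α` because `α
  -- ^ m (U) ⊆ U` supplies the one missing condition.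
  let U' : Subgroup N := ⨅ i ∈ Finset.range m, U.comap (α ^ (-i : ℤ)).toMonoidHom
  have hU' : ∀ x, x ∈ U' ↔ ∀ i < m, (α ^ (-i : ℤ)) x ∈ U := fun x => by
    simp only [U', Subgroup.mem_iInf, Finset.mem_range]; rfl
  have hU'o : IsOpen (U' : Set N) := by
    simp only [U', Subgroup.coe_iInf]
    exact isOpen_biInter_finset fun i _ => hUo.preimage (hα (-i))
  refine ⟨U', hU'o, hUc.of_isClosed_subset (Subgroup.isClosed_of_isOpen _ hU'o) fun x hx => ?_,
    fun x hx => ?_, fun x => ?_⟩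
  · simpa using (hU' x).1 hx 0 hm1
  · rw [hU'] at hx ⊢
    intro i hi
    have h1 : α x = (α ^ (1 : ℤ)) x := by simp
    rw [h1, MulAut.zpow_add_apply]
    rcases Nat.eq_zero_or_pos i with rfl | hi0
    · have := hm _ (hx (m - 1) (by omega))
      rw [MulAut.zpow_add_apply] at this
      convert! this using 3
      omega
    · have := hx (i - 1) (by omega)
      convert! this using 3
      omega
  · obtain ⟨l, hl⟩ := habs {x} isCompact_singleton
    refine ⟨k₀ + m + l, (hU' _).2 fun i hi => ?_⟩
    have := hk₀' _ (hl x rfl) (k₀ + m - i) (by omega)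
    rw [MulAut.zpow_add_apply] at this ⊢
    convert! this using 3
    push_cast; ring

end Compacting

/-! ### Compact open subgroups and focal decompositions -/

/-- A locally compact group with compact identity component has a compact open subgroup. -/
theorem exists_isCompact_isOpen_subgroup {N : Type*} [Group N] [TopologicalSpace N]
    [IsTopologicalGroup N] [LocallyCompactSpace N] [T2Space N]
    (h : IsCompact (connectedComponent (1 : N))) :
    ∃ V : Subgroup N, IsOpen (V : Set N) ∧ IsCompact (V : Set N) := by
  obtain ⟨K, hK, hNK⟩ := exists_compact_superset h
  have hKc : CompactSpace K := isCompact_iff_compactSpace.1 hK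
  have h1 : (1 : N) ∈ interior K := hNK mem_connectedComponent
  let e : K := ⟨1, interior_subset h1⟩
  have hcomp : connectedComponent e ⊆ (↑) ⁻¹' interior K := by
    intro x hx
    apply hNK
    exact (isPreconnected_connectedComponent.image _ continuous_subtype_val.continuousOn
      |>.subset_connectedComponent ⟨e, mem_connectedComponent, rfl⟩) ⟨x, hx, rfl⟩
  -- In the compact Hausdorff space `K` the component of `1` is an intersection of clopen sets, so
  -- some clopen `Z` lies in the interior of `K`. Then `Z` is compact and open in `N`, and its left
  -- stabilizer is the required subgroup.
  rw [connectedComponent_eq_iInter_isClopen] at hcomp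
  obtain ⟨Z, hZ⟩ : ∃ Z : {s : Set K // IsClopen s ∧ e ∈ s}, Z.1 ⊆ (↑) ⁻¹' interior K := by
    have : Nonempty {s : Set K // IsClopen s ∧ e ∈ s} := ⟨⟨Set.univ, isClopen_univ, trivial⟩⟩
    refine exists_subset_nhds_of_isCompact (fun s t => ⟨⟨s.1 ∩ t.1, s.2.1.inter t.2.1, s.2.2, t.2.2⟩,
      Set.inter_subset_left, Set.inter_subset_right⟩) (fun s => s.2.1.1.isCompact) fun x hx => ?_
    exact (isOpen_interior.preimage continuous_subtype_val).mem_nhds (hcomp hx)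
  have hc : IsCompact ((↑) '' Z.1 : Set N) := Z.2.1.1.isCompact.image continuous_subtype_val
  have ho : IsOpen ((↑) '' Z.1 : Set N) := by
    obtain ⟨O, hO, hOZ⟩ := isOpen_induced_iff.1 Z.2.1.2
    have : ((↑) '' Z.1 : Set N) = O ∩ interior K := by
      ext x
      constructor
      · rintro ⟨y, hy, rfl⟩
        exact ⟨by rw [← hOZ] at hy; exact hy, hZ hy⟩
      · rintro ⟨hx, hxK⟩
        exact ⟨⟨x, interior_subset hxK⟩, by rw [← hOZ]; exact hx, rfl⟩
    rw [this]
    exact hO.inter isOpen_interior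
  have hso := hc.isOpen_stabilizer ho
  refine ⟨_, hso, hc.of_isClosed_subset (Subgroup.isClosed_of_isOpen _ hso) fun x hx => ?_⟩
  rw [SetLike.mem_coe, MulAction.mem_stabilizer_iff] at hx
  rw [← hx]
  exact ⟨1, ⟨e, Z.2.2, rfl⟩, mul_one x⟩

/-- A locally compact group which is covered by translates of a compact set by an increasing
sequence of compact subgroups has a compact open subgroup. -/
theorem exists_isCompact_isOpen_subgroup_of_iUnion {N : Type*} [Group N] [TopologicalSpace N]
    [IsTopologicalGroup N] [LocallyCompactSpace N] [T2Space N] {V : ℕ → Subgroup N}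
    (hV : Monotone V) (hVc : ∀ k, IsCompact (V k : Set N)) {C : Set N} (hC : IsCompact C)
    (hcov : ∀ n, ∃ k, ∃ v ∈ V k, ∃ c ∈ C, v * c = n) :
    ∃ V : Subgroup N, IsOpen (V : Set N) ∧ IsCompact (V : Set N) := by
  obtain ⟨C₁, hC₁, h1⟩ := exists_compact_mem_nhds (1 : N)
  set O : Set N := C * interior C₁ with hO
  have hOo : IsOpen O := isOpen_interior.mul_left
  set D : Set N := C * C₁ ∪ (C * C₁)⁻¹ with hDdef
  have hD : IsCompact D := (hC.mul hC₁).union (hC.mul hC₁).inv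
  have hOD : O ⊆ D := (Set.mul_subset_mul_left interior_subset).trans Set.subset_union_left
  have hDinv : ∀ x ∈ D, x⁻¹ ∈ D := by
    rintro x (hx | hx)
    · exact Or.inr (by rwa [Set.mem_inv, inv_inv])
    · exact Or.inl hx
  have hcovO : ∀ n, ∃ k, n ∈ (V k : Set N) * O := fun n => by
    obtain ⟨k, v, hv, c, hc, rfl⟩ := hcov n
    exact ⟨k, Set.mul_mem_mul hv ⟨c, hc, 1, mem_interior_iff_mem_nhds.2 h1, mul_one c⟩⟩
  -- One subgroup suffices for the compact set `D D`: it is contained in `V k * O`, so `W = V k * D`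
  -- satisfies `W D ⊆ W`.
  obtain ⟨k, hk⟩ := (hD.mul hD).elim_directed_cover (fun k => (V k : Set N) * O)
    (fun k => hOo.mul_left) (fun n _ => Set.mem_iUnion.2 (hcovO n))
    (Monotone.directed_le fun i j hij => Set.mul_subset_mul_right (hV hij))
  set W : Set N := (V k : Set N) * D with hW
  have hWc : IsCompact W := (hVc k).mul hD
  have hWD : ∀ w ∈ W, ∀ d ∈ D, w * d ∈ W := by
    rintro _ ⟨v, hv, d, hd, rfl⟩ d' hd'
    obtain ⟨v', hv', o, ho, h⟩ := hk (Set.mul_mem_mul hd hd')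
    refine ⟨v * v', mul_mem hv hv', o, hOD ho, ?_⟩
    simp only at h ⊢
    rw [mul_assoc, h, mul_assoc]
  -- The right stabilizer of `W` is open because it contains `D ⊇ O`, and compact because `o L ⊆ W`
  -- for any `o ∈ O`.
  let L : Subgroup N :=
    { carrier := {x | ∀ w ∈ W, w * x ∈ W ∧ w * x⁻¹ ∈ W}
      mul_mem' := fun {a b} ha hb w hw => by
        rw [← mul_assoc, mul_inv_rev, ← mul_assoc]
        exact ⟨(hb _ (ha w hw).1).1, (ha _ (hb w hw).2).2⟩
      one_mem' := fun w hw => by simpa using hw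
      inv_mem' := fun {a} ha w hw => by
        rw [inv_inv]; exact (ha w hw).symm }
  have hDL : D ⊆ L := fun d hd w hw => ⟨hWD w hw d hd, hWD w hw _ (hDinv d hd)⟩
  obtain ⟨o, ho⟩ : O.Nonempty := by
    obtain ⟨-, -, -, c, hc, -⟩ := hcov 1
    exact ⟨c * 1, c, hc, 1, mem_interior_iff_mem_nhds.2 h1, rfl⟩
  have hLo : IsOpen (L : Set N) :=
    Subgroup.isOpen_of_mem_nhds L (g := o) (Filter.mem_of_superset (hOo.mem_nhds ho)
      (hOD.trans hDL))
  refine ⟨L, hLo, (hWc.image (continuous_const_mul o⁻¹)).of_isClosed_subset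
    (Subgroup.isClosed_of_isOpen _ hLo) fun x hx => ?_⟩
  have ho' : o ∈ W := ⟨1, one_mem _, o, hOD ho, one_mul o⟩
  exact ⟨o * x, (hx o ho').1, by simp⟩

/-- A continuous homomorphism to the reals is trivial on a compact subgroup. -/
theorem map_eq_one_of_mem_isCompact {A : Type*} [Group A] [TopologicalSpace A]
    {ψ : A →* Multiplicative ℝ} (hψ : Continuous ψ) {K : Subgroup A}
    (hK : IsCompact (K : Set A)) {x : A} (hx : x ∈ K) : ψ x = 1 := by
  obtain ⟨R, hR⟩ := (hK.image (continuous_toAdd.comp hψ)).isBounded.exists_norm_le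
  by_contra hne
  have hpos : 0 < ‖(ψ x).toAdd‖ := norm_pos_iff.2 fun h => hne h
  obtain ⟨n, hn⟩ := Archimedean.arch (R + 1) hpos
  have := hR _ ⟨x ^ n, pow_mem hx n, rfl⟩
  rw [Function.comp_apply, map_pow, toAdd_pow, nsmul_eq_mul, norm_mul, Real.norm_natCast] at this
  rw [nsmul_eq_mul] at hn
  linarith

/-- The kernel is a union of compact subgroups, on which real characters vanish. Hence every
continuous real character is a multiple of `χ`. -/
theorem Contraction.map_eq_one_of_mem_ker {A : Type*} [Group A] [TopologicalSpace A]
    [IsTopologicalGroup A] (C : Contraction A) {ψ : A →* Multiplicative ℝ} (hψ : Continuous ψ)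
    {x : A} (hx : x ∈ C.χ.ker) : ψ x = 1 := by
  obtain ⟨k, hk⟩ := C.exists_mem_level hx
  exact map_eq_one_of_mem_isCompact hψ (C.isCompact_level k) hk

/-- The kernel of a contraction is mapped by a copci homomorphism to a cocompact subset of the
kernel of any unbounded real character. -/
theorem Contraction.exists_isCompact_ker {A B : Type*} [Group A] [TopologicalSpace A]
    [IsTopologicalGroup A] (C : Contraction A) [Group B] [TopologicalSpace B]
    [IsTopologicalGroup B] [LocallyCompactSpace B]
    {f : A →* B} (hf : Continuous f) [CompactSpace (B ⧸ f.range)] {ψ : B →* Multiplicative ℝ}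
    (hψ : Continuous ψ) (hunb : ∀ R : ℝ, ∃ b, R < |(ψ b).toAdd|) :
    ∃ E : Set B, IsCompact E ∧ ∀ b, ψ b = 1 → ∃ x ∈ C.χ.ker, ∃ e ∈ E, f x * e = b := by
  obtain ⟨K, hK, hKcov⟩ := f.range.exists_isCompact_of_compactSpace_quotient
  set c : ℝ := (ψ (f C.t)).toAdd with hc
  have hψf : ∀ a, (ψ (f a)).toAdd = (C.χ a).toAdd * c := fun a => by
    have h := C.map_eq_one_of_mem_ker (ψ := ψ.comp f) (hψ.comp hf) (C.mul_zpow_mem_ker a)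
    rw [map_mul, map_inv, map_zpow, mul_inv_eq_one] at h
    change ψ (f a) = ψ (f C.t) ^ _ at h
    rw [h, toAdd_zpow, zsmul_eq_mul]
  obtain ⟨R, hR⟩ := (hK.image (continuous_toAdd.comp hψ)).isBounded.exists_norm_le
  have hR' : ∀ k ∈ K, |(ψ k).toAdd| ≤ R := fun k hk => hR _ ⟨k, hk, rfl⟩
  -- If `c = 0`, then `ψ` vanishes on the image of `f` and is bounded by `R` on all of `B`.
  have hc0 : c ≠ 0 := by
    intro h0
    obtain ⟨b, hb⟩ := hunb R
    obtain ⟨k, hk, a, ha⟩ := hKcov b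
    have := hψf a
    rw [ha, h0, mul_zero, map_mul, map_inv, toAdd_mul, toAdd_inv] at this
    have h2 := hR' k hk
    rw [show (ψ b).toAdd = (ψ k).toAdd by linarith] at hb
    linarith
  -- Write `b = f(a)⁻¹ k⁻¹` with `k ∈ K`. From `ψ b = 1` one gets `|χ a| ≤ R / |c|`, so removing the
  -- kernel part of `a⁻¹` leaves only finitely many powers of `t`.
  obtain ⟨M, hM⟩ := exists_nat_ge (R / |c|)
  refine ⟨⋃ j ∈ Finset.Icc (-M : ℤ) M, (fun b => f (C.t ^ j) * b) '' K⁻¹,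
    (Finset.Icc (-M : ℤ) M).isCompact_biUnion fun j _ => hK.inv.image (by fun_prop),
    fun b hb => ?_⟩
  obtain ⟨k, hk, a, ha⟩ := hKcov b⁻¹
  have hψa := hψf a
  rw [ha, map_mul, map_inv, map_inv, hb, inv_one, mul_one, toAdd_inv] at hψa
  have hbound : |((C.χ a).toAdd : ℝ)| ≤ M := by
    refine le_trans ?_ hM
    rw [le_div_iff₀ (abs_pos.2 hc0), ← abs_mul, ← hψa, abs_neg]
    exact hR' k hk
  have hbound' : |(C.χ a).toAdd| ≤ (M : ℤ) := by exact_mod_cast hbound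
  rw [abs_le] at hbound'
  refine ⟨_, C.mul_zpow_mem_ker a⁻¹, f (C.t ^ (C.χ a⁻¹).toAdd) * k⁻¹,
    Set.mem_iUnion₂.2 ⟨_, ?_, k⁻¹, by simpa using hk, rfl⟩, ?_⟩
  · rw [map_inv, toAdd_inv, Finset.mem_Icc]
    omega
  · have h1 : f a⁻¹ * k⁻¹ = b := by rw [map_inv, ha]; group
    rw [← mul_assoc, ← map_mul, inv_mul_cancel_right, h1]

/-- The kernel of an unbounded real character of the target of a copci homomorphism from a group
with a contraction has a compact open subgroup. -/
theorem Contraction.exists_subgroup_of_copci {A B N : Type*} [Group A] [TopologicalSpace A]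
    [IsTopologicalGroup A] (C : Contraction A) [Group B] [TopologicalSpace B]
    [IsTopologicalGroup B] [LocallyCompactSpace B] [T2Space B] [Group N] [TopologicalSpace N]
    [IsTopologicalGroup N]
    {f : A →* B} (hf : Continuous f) [CompactSpace (B ⧸ f.range)] {ψ : B →* Multiplicative ℝ}
    (hψ : Continuous ψ) (hunb : ∀ R : ℝ, ∃ b, R < |(ψ b).toAdd|) {ι : N →* B}
    (hι : Topology.IsClosedEmbedding ι) (hιψ : ∀ b, ψ b = 1 ↔ b ∈ ι.range) :
    ∃ V : Subgroup N, IsOpen (V : Set N) ∧ IsCompact (V : Set N) := by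
  have : LocallyCompactSpace N := hι.locallyCompactSpace
  have : T2Space N := hι.isEmbedding.t2Space
  obtain ⟨E, hE, hcov⟩ := C.exists_isCompact_ker hf hψ hunb
  -- The kernel of `ψ` is `f(ker χ) * E` cut down to that kernel, and `f(ker χ)` is the increasing
  -- union of these compact subgroups.
  have hmono : Monotone fun k : ℕ => ((C.level k).map f).comap ι := fun i j hij =>
    Subgroup.comap_mono (Subgroup.map_mono (C.level_mono (by exact_mod_cast hij)))
  refine exists_isCompact_isOpen_subgroup_of_iUnion hmono
    (fun k => hι.isCompact_preimage ((C.isCompact_level k).image hf))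
    (hι.isCompact_preimage hE) fun n => ?_
  obtain ⟨x, hx, e, he, hxe⟩ := hcov (ι n) ((hιψ _).2 ⟨n, rfl⟩)
  obtain ⟨v, hv⟩ := (hιψ _).1 (C.map_eq_one_of_mem_ker (ψ := ψ.comp f) (hψ.comp hf) hx)
  obtain ⟨i, hi⟩ := C.exists_mem_level hx
  refine ⟨i, v, ⟨x, hi, hv.symm⟩, v⁻¹ * n, ?_, by simp⟩
  rw [Set.mem_preimage, map_mul, map_inv, hv, ← hxe, inv_mul_cancel_left]
  exact he

/-! ### From focal decompositions to contractions -/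

namespace FocalDecomposition

variable {Λ : Type} [AddCommGroup Λ] [LT Λ] [TopologicalSpace Λ] {G : TopGroup.{u}}
  (D : FocalDecomposition Λ G)

/-- The inclusion of the kernel. -/
def ι : D.N →* G := D.iso.symm.toMulEquiv.toMonoidHom.comp SemidirectProduct.inl

/-- The projection onto the quotient. -/
def π : G →* Multiplicative Λ := SemidirectProduct.rightHom.comp D.iso.toMulEquiv.toMonoidHom

/-- The lift of an element of the quotient. -/
def lift (t : Multiplicative Λ) : G := D.iso.symm (SemidirectProduct.inr t)

theorem iso_ι (n : D.N) : D.iso (D.ι n) = SemidirectProduct.inl n :=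
  D.iso.apply_symm_apply _

theorem π_ι (n : D.N) : D.π (D.ι n) = 1 := by
  change (D.iso (D.ι n)).right = 1
  rw [iso_ι]; rfl

theorem π_lift (t : Multiplicative Λ) : D.π (D.lift t) = t := by
  change (D.iso (D.iso.symm _)).right = t
  rw [D.iso.apply_symm_apply]; rfl

theorem conj_ι (t : Multiplicative Λ) (n : D.N) :
    D.lift t * D.ι n * (D.lift t)⁻¹ = D.ι (D.φ t n) := by
  apply D.iso.injective
  rw [map_mul, map_mul, map_inv, iso_ι, iso_ι, lift, D.iso.apply_symm_apply,
    SemidirectProduct.inl_aut, map_inv]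

theorem ι_injective : Function.Injective D.ι :=
  D.iso.symm.injective.comp SemidirectProduct.inl_injective

theorem π_eq_one_iff {x : G} : D.π x = 1 ↔ x ∈ D.ι.range := by
  constructor
  · intro h
    refine ⟨(D.iso x).left, D.iso.injective ?_⟩
    rw [iso_ι]
    exact SemidirectProduct.ext rfl h.symm
  · rintro ⟨n, rfl⟩
    exact D.π_ι n

theorem continuous_equivProd {N L : Type*} [Group N] [Group L] [TopologicalSpace N]
    [TopologicalSpace L] (φ : L →* MulAut N) :
    Continuous (SemidirectProduct.equivProd : N ⋊[φ] L ≃ N × L) := continuous_induced_dom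

theorem continuous_ι : Continuous D.ι :=
  D.iso.symm.continuous.comp (continuous_induced_rng.2
    (continuous_id.prodMk continuous_const : Continuous fun n : D.N => (n, (1 : Multiplicative Λ))))

theorem continuous_π : Continuous D.π :=
  (continuous_snd.comp (continuous_equivProd D.φ)).comp D.iso.continuous

theorem isClosedEmbedding_ι [T2Space G] : Topology.IsClosedEmbedding D.ι :=
  Function.LeftInverse.isClosedEmbedding (f := fun x => (D.iso x).left)
    (fun n => congrArg SemidirectProduct.left (D.iso_ι n))
    ((continuous_fst.comp (continuous_equivProd D.φ)).comp D.iso.continuous) D.continuous_ι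

theorem continuous_φ (t : Multiplicative Λ) : Continuous (D.φ t) :=
  D.continuous_action.comp (continuous_const.prodMk continuous_id)

/-- In a focal decomposition over `ℤ`, a compact open subgroup of the kernel yields a
contraction. -/
theorem nonempty_contraction (D : FocalDecomposition ℤ G) {V : Subgroup D.N}
    (hVo : IsOpen (V : Set D.N)) (hVc : IsCompact (V : Set D.N)) : Nonempty (Contraction G) := by
  have : T2Space D.N := D.isLCGroup.2
  set α := D.φ (Multiplicative.ofAdd 1) with hα
  have hzpow : ∀ k : ℤ, α ^ k = D.φ (Multiplicative.ofAdd k) := fun k => by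
    rw [hα, ← map_zpow, ← ofAdd_zsmul]; simp
  have hcont : ∀ k : ℤ, Continuous (α ^ k) := fun k => by
    rw [hzpow]; exact D.continuous_φ _
  obtain ⟨U, hUo, hUc, hU, habs⟩ := (D.compacting 1 one_pos).exists_subgroup hcont hVo hVc
  have hconj : ∀ (k : ℤ) (n : D.N), (D.lift (Multiplicative.ofAdd 1)) ^ k * D.ι n *
      ((D.lift (Multiplicative.ofAdd 1)) ^ k)⁻¹ = D.ι ((α ^ k) n) := fun k n => by
    have : D.lift (Multiplicative.ofAdd 1) ^ k = D.lift (Multiplicative.ofAdd k) := by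
      rw [lift, lift, ← map_zpow, ← map_zpow, ← ofAdd_zsmul]; simp
    rw [this, conj_ι, hzpow]
  have hmem : ∀ n, D.ι n ∈ U.map D.ι ↔ n ∈ U := fun n =>
    Subgroup.mem_map_iff_mem D.ι_injective
  refine ⟨{
    χ := D.π
    U := U.map D.ι
    t := D.lift (Multiplicative.ofAdd 1)
    isOpen := ?_
    isCompact := by rw [Subgroup.coe_map]; exact hUc.image D.continuous_ι
    U_le := ?_
    χ_t := D.π_lift _
    conj_mem := ?_
    absorb := ?_
    proper := ?_ }⟩
  · have : ((U.map D.ι : Subgroup G) : Set G) = (fun x => (D.iso x).left) ⁻¹' U ∩ D.π ⁻¹' {1} := by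
      ext x
      constructor
      · rintro ⟨n, hn, rfl⟩
        refine ⟨?_, D.π_ι n⟩
        rw [Set.mem_preimage, iso_ι]
        exact hn
      · rintro ⟨hx, h1⟩
        obtain ⟨n, rfl⟩ := D.π_eq_one_iff.1 h1
        rw [Set.mem_preimage, iso_ι] at hx
        exact ⟨n, hx, rfl⟩
    rw [this]
    exact (hUo.preimage ((continuous_fst.comp (continuous_equivProd D.φ)).comp
      D.iso.continuous)).inter ((isOpen_discrete _).preimage D.continuous_π)
  · rintro _ ⟨n, -, rfl⟩
    exact D.π_ι n
  · rintro _ ⟨n, hn, rfl⟩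
    rw [conj_ι, hmem]
    exact hU n hn
  · intro x hx
    obtain ⟨n, rfl⟩ := D.π_eq_one_iff.1 hx
    obtain ⟨k, hk⟩ := habs n
    refine ⟨k, ?_⟩
    rw [← zpow_natCast, hconj, hmem]
    exact hk
  -- If `t⁻¹ U t ⊆ U`, then `U` is also backward invariant; being absorbing it is all of `N`, which
  -- would be compact.
  · by_contra! hcon
    have hstep : ∀ n ∈ U, (α ^ (-1 : ℤ)) n ∈ U := fun n hn => by
      have := hcon (D.ι n) ((hmem n).2 hn)
      have h1 := hconj (-1) n
      rw [zpow_neg_one, inv_inv] at h1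
      rwa [h1, hmem] at this
    have hback : ∀ (k : ℕ) (n : D.N), (α ^ (k : ℤ)) n ∈ U → n ∈ U := by
      intro k
      induction k with
      | zero => intro n hn; simpa using hn
      | succ k ih =>
        intro n hn
        apply ih
        have := hstep _ hn
        rw [MulAut.zpow_add_apply] at this
        convert! this using 3
        push_cast; ring
    refine D.noncompact ⟨?_⟩
    convert hUc
    refine (Set.eq_univ_of_forall fun n => ?_).symm
    obtain ⟨k, hk⟩ := habs n
    exact hback k n hk

/-- In a focal decomposition over `ℝ`, the kernel has no compact open subgroup. -/
theorem not_isCompact_of_isOpen (D : FocalDecomposition ℝ G) {V : Subgroup D.N}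
    (hVo : IsOpen (V : Set D.N)) : ¬ IsCompact (V : Set D.N) := by
  intro hVc
  -- For fixed `x` this set of times is clopen in `ℝ` and contains `0`: the flow preserves each
  -- coset `x V`. Compacting then gives `N = Ω V`.
  have hV : ∀ (t : ℝ) (x : D.N), x⁻¹ * D.φ (Multiplicative.ofAdd t) x ∈ V := fun t x => by
    have hcl : IsClopen ((fun t : ℝ => x⁻¹ * D.φ (Multiplicative.ofAdd t) x) ⁻¹' V) :=
      IsClopen.preimage ⟨V.isClosed_of_isOpen hVo, hVo⟩
        (continuous_const.mul (D.continuous_action.comp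
          (continuous_ofAdd.prodMk continuous_const)))
    have := hcl.eq_univ ⟨0, by simp⟩
    exact (Set.eq_univ_iff_forall.1 this) t
  obtain ⟨Ω, hΩ, habs⟩ := D.compacting 1 one_pos
  refine D.noncompact ⟨?_⟩
  convert hΩ.mul hVc
  refine (Set.eq_univ_of_forall fun x => ?_).symm
  obtain ⟨n, -, hn⟩ := habs {x} isCompact_singleton
  have hx := hn ⟨x, rfl, rfl⟩
  rw [MulAut.iterate_apply, ← map_zpow, ← ofAdd_zsmul] at hx
  exact ⟨_, hx, _, inv_mem (hV ((n : ℤ) • (1 : ℝ)) x), by simp⟩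

end FocalDecomposition

/-- A focal group whose kernel has a compact open subgroup has a contraction. -/
theorem IsFocalTD.nonempty_contraction {G : TopGroup.{u}} (h : IsFocalTD G) :
    Nonempty (Contraction G) := by
  obtain ⟨-, ⟨D, hD⟩ | ⟨D, hD⟩⟩ := h
  all_goals
    have := D.isLCGroup.1
    have := D.isLCGroup.2
    obtain ⟨V, hVo, hVc⟩ := exists_isCompact_isOpen_subgroup hD
  · exact D.nonempty_contraction hVo hVc
  · exact absurd hVc (D.not_isCompact_of_isOpen hVo)

/-- The kernel of the projection of `B` has a compact open subgroup by `exists_subgroup_of_copci`,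
with `ℤ` viewed in `ℝ` in the first case; in the second case this is absurd. -/
theorem IsFocal.nonempty_contraction_of_copci_right {A B : TopGroup.{u}} (C : Contraction A)
    (hB : IsFocal B) (hAB : Copci A B) : Nonempty (Contraction B) := by
  obtain ⟨f, hf, hfc⟩ := hAB
  obtain ⟨⟨_, _⟩, ⟨⟨D⟩⟩ | ⟨⟨D⟩⟩⟩ := hB
  · have hc : Continuous (AddMonoidHom.toMultiplicative (Int.castAddHom ℝ)) :=
      continuous_of_discreteTopology
    obtain ⟨V, hVo, hVc⟩ := C.exists_subgroup_of_copci hf.continuous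
      (ψ := (AddMonoidHom.toMultiplicative (Int.castAddHom ℝ)).comp D.π) (hc.comp D.continuous_π)
      (fun R => by
        obtain ⟨n, hn⟩ := exists_nat_gt R
        refine ⟨D.lift (Multiplicative.ofAdd (n : ℤ)), ?_⟩
        rw [MonoidHom.comp_apply, D.π_lift]
        simpa using hn)
      D.isClosedEmbedding_ι (fun b => by
        rw [← D.π_eq_one_iff, MonoidHom.comp_apply]
        exact Int.cast_eq_zero (α := ℝ))
    exact D.nonempty_contraction hVo hVc
  · obtain ⟨V, hVo, hVc⟩ := C.exists_subgroup_of_copci hf.continuous (ψ := D.π) D.continuous_π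
      (fun R => by
        refine ⟨D.lift (Multiplicative.ofAdd (|R| + 1)), ?_⟩
        rw [D.π_lift, toAdd_ofAdd, abs_of_pos (by positivity)]
        linarith [le_abs_self R])
      D.isClosedEmbedding_ι (fun b => D.π_eq_one_iff)
    exact absurd hVc (D.not_isCompact_of_isOpen hVo)

/-- Pulling back `U` to the kernel of the projection of `B` gives an open subgroup, compact because
the composite with the closed embedding is proper. -/
theorem IsFocal.nonempty_contraction_of_copci_left {A B : TopGroup.{u}} (C : Contraction A)
    (hB : IsFocal B) (hBA : Copci B A) : Nonempty (Contraction B) := by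
  obtain ⟨f, hf, -⟩ := hBA
  obtain ⟨⟨_, _⟩, ⟨⟨D⟩⟩ | ⟨⟨D⟩⟩⟩ := hB
  all_goals
    have hVo : IsOpen (C.U.comap (f.comp D.ι) : Set D.N) :=
      C.isOpen.preimage (hf.continuous.comp D.continuous_ι)
    have hVc : IsCompact (C.U.comap (f.comp D.ι) : Set D.N) :=
      (hf.comp D.isClosedEmbedding_ι.isProperMap).isCompact_preimage C.isCompact
  · exact D.nonempty_contraction hVo hVc
  · exact absurd hVc (D.not_isCompact_of_isOpen hVo)

/-! ### The scale of a contraction -/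

/-- This is orbit-stabilizer for `K` acting on `B ⧸ H`; both sides are `0` when the orbit is
infinite. -/
theorem Subgroup.relIndex_eq_ncard {B : Type*} [Group B] (H K : Subgroup B) :
    H.relIndex K = ((fun b : B => (b : B ⧸ H)) '' (K : Set B)).ncard := by
  have h1 : H.subgroupOf K = MulAction.stabilizer K ((1 : B) : B ⧸ H) := by
    ext x
    rw [Subgroup.mem_subgroupOf, MulAction.mem_stabilizer_iff, eq_comm]
    change _ ↔ ((1 : B) : B ⧸ H) = ((x * 1 : B) : B ⧸ H)
    rw [QuotientGroup.eq]
    simp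
  rw [Subgroup.relIndex, h1, MulAction.index_stabilizer]
  congr 1
  ext q
  constructor
  · rintro ⟨k, rfl⟩
    exact ⟨k, k.2, congrArg _ (mul_one (k : B)).symm⟩
  · rintro ⟨k, hk, rfl⟩
    exact ⟨⟨k, hk⟩, congrArg _ (mul_one k)⟩

theorem Subgroup.relIndex_eq_ncard_image {B S : Type*} [Group B] {H K : Subgroup B} {f : B → S}
    (hf : ∀ b c, f b = f c ↔ b⁻¹ * c ∈ H) : H.relIndex K = (f '' K).ncard := by
  let F : B ⧸ H → S := Quotient.lift f fun b c h =>
    (hf b c).2 (QuotientGroup.leftRel_apply.1 h)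
  have hF : Function.Injective F := by
    intro q q'
    induction q using QuotientGroup.induction_on with
    | H b =>
      induction q' using QuotientGroup.induction_on with
      | H c => exact fun h => QuotientGroup.eq.2 ((hf b c).1 h)
  rw [relIndex_eq_ncard, ← Set.ncard_image_of_injective _ hF, Set.image_image]
  rfl

theorem Subgroup.relIndex_eq_of_subset_mul {B : Type*} [Group B] {H K L : Subgroup B} (hKL : K ≤ L)
    (h : (L : Set B) ⊆ K * H) : H.relIndex K = H.relIndex L := by
  rw [relIndex_eq_ncard, relIndex_eq_ncard]
  congr 1
  refine Set.Subset.antisymm (Set.image_mono hKL) ?_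
  rintro _ ⟨l, hl, rfl⟩
  obtain ⟨k, hk, x, hx, rfl⟩ := h hl
  refine ⟨k, hk, QuotientGroup.eq.2 ?_⟩
  simpa using hx

theorem Subgroup.relIndex_ne_zero_of_isCompact {A : Type*} [Group A] [TopologicalSpace A]
    [IsTopologicalGroup A] {H K : Subgroup A} (hH : IsOpen (H : Set A))
    (hK : IsCompact (K : Set A)) : H.relIndex K ≠ 0 := by
  have hc : CompactSpace K := isCompact_iff_compactSpace.1 hK
  have ho : IsOpen (H.subgroupOf K : Set K) := hH.preimage continuous_subtype_val
  have := Subgroup.quotient_finite_of_isOpen _ ho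
  exact (Subgroup.finiteIndex_of_finite_quotient (H := H.subgroupOf K)).index_ne_zero

namespace Contraction

variable {A : Type*} [Group A] [TopologicalSpace A]

/-- The real character underlying the character of a contraction. -/
noncomputable def realχ (C : Contraction A) : A →* Multiplicative ℝ :=
  (AddMonoidHom.toMultiplicative (Int.castAddHom ℝ)).comp C.χ

theorem realχ_eq_one {C : Contraction A} {x : A} : C.realχ x = 1 ↔ x ∈ C.χ.ker :=
  Int.cast_eq_zero (α := ℝ)

theorem exists_lt_realχ (C : Contraction A) (R : ℝ) : ∃ b, R < |(C.realχ b).toAdd| := by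
  obtain ⟨n, hn⟩ := exists_nat_gt R
  refine ⟨C.t ^ (n : ℤ), ?_⟩
  rw [realχ, MonoidHom.comp_apply, χ_t_zpow]
  simpa using hn

variable [IsTopologicalGroup A]

theorem continuous_realχ (C : Contraction A) : Continuous C.realχ :=
  Continuous.comp (g := AddMonoidHom.toMultiplicative (Int.castAddHom ℝ))
    continuous_of_discreteTopology C.continuous_χ

/-- The scale may be computed on any contracted compact open subgroup of the kernel. -/
theorem relIndex_eq_scale (C : Contraction A) {W W' : Subgroup A} (hWo : IsOpen (W : Set A))
    (hWc : IsCompact (W : Set A)) (hW : W ≤ C.χ.ker) (hle : W' ≤ W)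
    (hW' : ∀ x, C.t * x * C.t⁻¹ ∈ W' ↔ x ∈ W) : W'.relIndex W = C.scale := by
  obtain ⟨p, hp⟩ := C.subset_level hWc hW
  have hmap : ∀ x, x ∈ W' ↔ C.t⁻¹ * x * C.t ∈ W := fun x => by
    rw [← hW']
    congr! 1
    group
  have hW'p : W' ≤ C.level (p - 1) := fun x hx => by
    have h1 : C.t⁻¹ * x * C.t ∈ C.level p := hp ((hmap x).1 hx)
    have h2 := C.conj_mem_level (k := p) (j := -1) (x := x)
    rw [zpow_neg_one, inv_inv] at h2
    exact h2.1 h1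
  have hcomap : W'.comap (MulAut.conj C.t).toMonoidHom = W := by
    ext x; exact hW' x
  have hlev : (C.level p).map (MulAut.conj C.t).toMonoidHom = C.level (p - 1) := by
    have := C.map_level (p - 1) 1
    rwa [sub_add_cancel, zpow_one] at this
  -- With `L = level p`, the index of `W'` in `L` is computed through `W` and through `t L t⁻¹`.
  -- Conjugation identifies the index of `W'` in `t L t⁻¹` with that of `W` in `L`; this finite
  -- factor cancels.
  have h1 : W'.relIndex (C.level (p - 1)) = W.relIndex (C.level p) := by
    rw [← hlev, ← Subgroup.relIndex_comap, hcomap]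
  have h2 := Subgroup.relIndex_mul_relIndex _ _ _ hle hp
  have h3 := Subgroup.relIndex_mul_relIndex _ _ _ hW'p (C.level_mono (by omega : (p - 1 : ℤ) ≤ p))
  have h4 := C.relIndex_level_succ (p - 1)
  rw [sub_add_cancel] at h4
  rw [h1, h4, ← h2, mul_comm] at h3
  exact (Nat.eq_of_mul_eq_mul_right
    (Nat.pos_of_ne_zero (Subgroup.relIndex_ne_zero_of_isCompact hWo (C.isCompact_level p))) h3).symm

/-- A copci homomorphism multiplies the logarithm of the scale by an integer. -/
theorem exists_scale_eq_pow {B : Type*} [Group B] [TopologicalSpace B] [IsTopologicalGroup B]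
    (C : Contraction A) (D : Contraction B) {f : A →* B} (hf : IsProperMap f)
    [CompactSpace (B ⧸ f.range)] : ∃ k : ℕ, 1 ≤ k ∧ C.scale = D.scale ^ k := by
  have := D.locallyCompactSpace
  have hker : ∀ x ∈ C.χ.ker, f x ∈ D.χ.ker := fun x hx =>
    realχ_eq_one.1 (C.map_eq_one_of_mem_ker (ψ := D.realχ.comp f)
      (D.continuous_realχ.comp hf.continuous) hx)
  -- This will be the exponent. Write `f t = n * D.t ^ c` with `n` in level `j`. For `i ≥ j`
  -- conjugation by `n` preserves level `i`, so conjugation by `f t` moves levels as `D.t ^ c` does.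
  set c : ℤ := (D.χ (f C.t)).toAdd with hc
  obtain ⟨j, hj⟩ := D.exists_mem_level (D.mul_zpow_mem_ker (f C.t))
  rw [← hc] at hj
  have hft : f C.t = (f C.t * (D.t ^ c)⁻¹) * D.t ^ c := by simp
  set n := f C.t * (D.t ^ c)⁻¹ with hn
  have hconj : ∀ i : ℤ, j ≤ i → ∀ x, C.t * x * C.t⁻¹ ∈ (D.level i).comap f ↔
      x ∈ (D.level (i + c)).comap f := fun i hi x => by
    have hni : n ∈ D.level i := D.level_mono hi hj
    rw [Subgroup.mem_comap, Subgroup.mem_comap, ← D.conj_mem_level, map_mul, map_mul, map_inv, hft]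
    have : n * D.t ^ c * f x * (n * D.t ^ c)⁻¹ = n * (D.t ^ c * f x * (D.t ^ c)⁻¹) * n⁻¹ := by
      group
    rw [this, Subgroup.mul_mem_cancel_right _ (inv_mem hni), Subgroup.mul_mem_cancel_left _ hni]
  have hcompact : ∀ i : ℤ, IsCompact ((D.level i).comap f : Set A) := fun i =>
    hf.isCompact_preimage (D.isCompact_level i)
  have hopen : ∀ i : ℤ, IsOpen ((D.level i).comap f : Set A) := fun i =>
    (D.isOpen_level i).preimage hf.continuous
  obtain ⟨i₀, hi₀⟩ := D.subset_level (C.isCompact.image hf.continuous) (by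
    rintro _ ⟨x, hx, rfl⟩; exact hker x (C.U_le hx))
  -- If `c ≤ 0`, the compact preimage of a high level absorbs the kernel and is stable under
  -- conjugation by `t⁻¹`, so it contains the kernel, which is not compact.
  have hcpos : 1 ≤ c := by
    by_contra! hc1
    refine C.not_compactSpace_ker (isCompact_iff_compactSpace.1
      ((hcompact (max i₀ j)).of_isClosed_subset (C.χ.ker.isClosed_of_isOpen C.isOpen_coe_ker) ?_))
    intro x hx
    obtain ⟨k, hk⟩ := C.absorb x hx
    have hk' : C.t ^ k * x * (C.t ^ k)⁻¹ ∈ (D.level (max i₀ j)).comap f :=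
      D.level_mono (le_max_left _ _) (hi₀ ⟨_, hk, rfl⟩)
    clear hk
    induction k with
    | zero => simpa using hk'
    | succ k ih =>
      refine ih (D.level_mono (by omega : max (i₀ : ℤ) j + c ≤ _)
        ((hconj _ (le_max_right _ _) _).1 ?_))
      convert! hk' using 1
      rw [pow_succ']
      group
  obtain ⟨E, hE, hcov⟩ := C.exists_isCompact_ker hf.continuous D.continuous_realχ D.exists_lt_realχ
  obtain ⟨j₁, hj₁⟩ := D.subset_level (hE.inter_right
    (D.χ.ker.isClosed_of_isOpen D.isOpen_coe_ker)) Set.inter_subset_right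
  set i : ℤ := max j j₁ with hi
  have hker' : (D.level (i + c)).comap f ≤ C.χ.ker := fun x hx => by
    have h1 : D.χ (f x) = 1 := D.level_le_ker _ hx
    have h2 : D.χ (f (x * (C.t ^ (C.χ x).toAdd)⁻¹)) = 1 := hker _ (C.mul_zpow_mem_ker x)
    rw [map_mul, map_mul, h1, one_mul, map_inv, map_inv, inv_eq_one, map_zpow, map_zpow] at h2
    have h3 : (C.χ x).toAdd * c = 0 := by
      have := congrArg Multiplicative.toAdd h2
      rwa [toAdd_zpow, smul_eq_mul, toAdd_one] at this
    rcases mul_eq_zero.1 h3 with h | h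
    · exact h
    · omega
  have hscale := C.relIndex_eq_scale (hopen _) (hcompact _) hker'
    (Subgroup.comap_mono (D.level_mono (by omega : i ≤ i + c))) (hconj i (le_max_left _ _))
  refine ⟨c.toNat, by omega, ?_⟩
  rw [← hscale, Subgroup.relIndex_comap, ← D.relIndex_level i, Int.toNat_of_nonneg (by omega)]
  -- The scale of `C` is computed on the preimages of levels `i + c` and `i`. The image of the
  -- larger preimage meets every coset of level `i` in level `i + c`, because `E ∩ ker` lies in
  -- level `i`; so no index is lost in passing to `B`.
  refine Subgroup.relIndex_eq_of_subset_mul (Subgroup.map_comap_le _ _) fun b hb => ?_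
  obtain ⟨x, hx, e, he, rfl⟩ := hcov b (realχ_eq_one.2 (D.level_le_ker _ hb))
  have hei : e ∈ D.level i := D.level_mono (le_max_right _ _) (hj₁ ⟨he, by
    have := D.level_le_ker _ hb
    exact (Subgroup.mul_mem_cancel_left _ (hker x hx)).1 this⟩)
  refine Set.mul_mem_mul ⟨x, ?_, rfl⟩ hei
  exact (Subgroup.mul_mem_cancel_right _ (D.level_mono (by omega) hei)).1 hb

end Contraction

/-! ### The modular character -/

open MeasureTheory Measure in
-- The restriction of `μ` to the open subgroup `K` is left invariant, so the finite-index formula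
-- applies inside `K`.
theorem Subgroup.relIndex_mul_measure {A : Type*} [Group A] [TopologicalSpace A]
    [IsTopologicalGroup A] [MeasurableSpace A] [BorelSpace A] (μ : Measure A)
    [μ.IsMulLeftInvariant] {H K : Subgroup A} (hH : IsOpen (H : Set A)) (hK : IsOpen (K : Set A))
    (hle : H ≤ K) (hHK : H.relIndex K ≠ 0) : H.relIndex K * μ H = μ K := by
  have hemb : MeasurableEmbedding ((↑) : K → A) := .subtype_coe hK.measurableSet
  have : (μ.comap ((↑) : K → A)).IsMulLeftInvariant := ⟨fun k => by
    refine Measure.ext fun S hS => ?_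
    have himg : ((↑) '' ((k * ·) ⁻¹' S) : Set A) = (fun x => (k : A) * x) ⁻¹' ((↑) '' S) := by
      ext x
      constructor
      · rintro ⟨y, hy, rfl⟩
        exact ⟨k * y, hy, rfl⟩
      · rintro ⟨y, hy, hyx⟩
        refine ⟨k⁻¹ * y, by simpa using hy, ?_⟩
        simp [hyx]
    rw [map_apply (measurable_const_mul k) hS, hemb.comap_apply, hemb.comap_apply, himg,
      measure_preimage_mul]⟩
  have : (H.subgroupOf K).FiniteIndex := ⟨hHK⟩
  have h := (H.subgroupOf K).index_mul_measure
    (hH.preimage continuous_subtype_val).measurableSet (μ.comap ((↑) : K → A))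
  have himg : ((↑) '' (H.subgroupOf K : Set K) : Set A) = H := by
    ext x
    constructor
    · rintro ⟨y, hy, rfl⟩
      exact hy
    · exact fun hx => ⟨⟨x, hle hx⟩, hx, rfl⟩
  rwa [hemb.comap_apply, hemb.comap_apply, Set.image_univ, Subtype.range_coe, himg] at h

namespace Contraction

variable {A : Type*} [Group A] [TopologicalSpace A] [IsTopologicalGroup A] [LocallyCompactSpace A]
  (C : Contraction A)

open MeasureTheory Measure in
theorem modularCharacter_mul_measure [MeasurableSpace A] [BorelSpace A] (k : ℤ) (g : A) :
    (haar : Measure A) ((fun x => x * g) ⁻¹' (C.level k)) =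
      modularCharacter g * (haar : Measure A) (C.level k) := by
  have h := measure_isMulInvariant_eq_smul_of_isCompact_closure (map (· * g) haar)
    (haar : Measure A) (s := C.level k) (by
      rw [((C.level k).isClosed_of_isOpen (C.isOpen_level k)).closure_eq]
      exact C.isCompact_level k)
  rw [map_apply (measurable_mul_const g) (C.isOpen_level k).measurableSet,
    ← modularCharacterFun_eq_haarScalarFactor] at h
  exact h

open MeasureTheory Measure in
-- Right translation by an element of a level preserves that level, which has finite positive
-- measure.
theorem modularCharacter_of_mem_ker {x : A} (hx : x ∈ C.χ.ker) : modularCharacter x = 1 := by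
  borelize A
  obtain ⟨k, hk⟩ := C.exists_mem_level hx
  have h := C.modularCharacter_mul_measure k x
  have h1 : (fun y => y * x) ⁻¹' (C.level k : Set A) = C.level k := by
    ext y
    exact Subgroup.mul_mem_cancel_right _ hk
  have h0 : (haar : Measure A) (C.level k) ≠ 0 :=
    ((C.isOpen_level k).measure_pos _ ⟨1, one_mem _⟩).ne'
  have hT : (haar : Measure A) (C.level k) ≠ ⊤ := (C.isCompact_level k).measure_ne_top
  rw [h1, eq_comm] at h
  nth_rewrite 2 [← one_mul ((haar : Measure A) (C.level k))] at h
  exact_mod_cast (ENNReal.mul_left_inj h0 hT).1 h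

open MeasureTheory Measure in
-- Up to left translation, `U t⁻¹` is `t U t⁻¹`, whose measure is that of `U` divided by the scale.
theorem scale_mul_modularCharacter_t : C.scale * modularCharacter C.t = 1 := by
  borelize A
  have h := C.modularCharacter_mul_measure 0 C.t
  have h1 : (haar : Measure A) ((fun y => y * C.t) ⁻¹' (C.level 0 : Set A)) =
      (haar : Measure A) (C.level (-1)) := by
    rw [← measure_preimage_mul haar (C.t)⁻¹]
    congr 1
    ext y
    have h2 := C.conj_mem_level (k := 0) (j := -1) (x := y)
    rw [zpow_neg_one, inv_inv, zero_add] at h2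
    exact h2
  have h0 : (haar : Measure A) (C.level 0) ≠ 0 :=
    ((C.isOpen_level 0).measure_pos _ ⟨1, one_mem _⟩).ne'
  have hT : (haar : Measure A) (C.level 0) ≠ ⊤ := (C.isCompact_level 0).measure_ne_top
  have h3 := Subgroup.relIndex_mul_measure (haar : Measure A) (C.isOpen_level (-1))
    (C.isOpen_level 0) (C.level_mono (by omega)) C.scale_ne_zero
  rw [h1] at h
  rw [h, ← mul_assoc] at h3
  nth_rewrite 2 [← one_mul ((haar : Measure A) (C.level 0))] at h3
  exact_mod_cast (ENNReal.mul_left_inj h0 hT).1 h3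

open MeasureTheory Measure in
theorem modularCharacter_eq (x : A) :
    modularCharacter x = (C.scale : ℝ≥0) ^ (-(C.χ x).toAdd) := by
  have ht : modularCharacter C.t = (C.scale : ℝ≥0)⁻¹ :=
    eq_inv_of_mul_eq_one_right C.scale_mul_modularCharacter_t
  have hinv : ∀ y : A, modularCharacter y⁻¹ = (modularCharacter y)⁻¹ := fun y =>
    eq_inv_of_mul_eq_one_left (by rw [← map_mul, inv_mul_cancel, map_one])
  conv_lhs => rw [← inv_mul_cancel_right x (C.t ^ (C.χ x).toAdd)]
  have h1 := C.modularCharacter_of_mem_ker (C.mul_zpow_mem_ker x)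
  rw [map_mul, hinv] at h1
  rw [mul_assoc, map_mul, map_mul, hinv, ← mul_assoc, h1, one_mul, map_zpow' _ hinv, ht, inv_zpow,
    zpow_neg]

theorem modularRangeGeneratedBy : ModularRangeGeneratedBy A C.scale := by
  intro x
  constructor
  · rintro ⟨g, rfl⟩
    exact ⟨_, C.modularCharacter_eq g⟩
  · rintro ⟨k, rfl⟩
    refine ⟨C.t ^ (-k), ?_⟩
    rw [modularCharacter_eq, χ_t_zpow, toAdd_ofAdd, neg_neg]

end Contraction

/-! ### The invariants `s` and `q` -/

theorem ModularRangeGeneratedBy.unique {G : Type*} [Group G] [TopologicalSpace G]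
    [IsTopologicalGroup G] [LocallyCompactSpace G] {s r : ℕ} (hs : 2 ≤ s) (hr : 2 ≤ r)
    (h : ModularRangeGeneratedBy G s) (h' : ModularRangeGeneratedBy G r) : s = r := by
  have key : ∀ {s r : ℕ}, 2 ≤ s → 2 ≤ r → ModularRangeGeneratedBy G s →
      ModularRangeGeneratedBy G r → r ≤ s := by
    intro s r hs hr h h'
    obtain ⟨k, hk⟩ := (h' s).1 ((h s).2 ⟨1, (zpow_one _).symm⟩)
    have hr1 : (1 : ℝ≥0) ≤ r := by exact_mod_cast (by omega : 1 ≤ r)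
    have hs1 : (1 : ℝ≥0) < s := by exact_mod_cast (by omega : 1 < s)
    have hk0 : 1 ≤ k := by
      by_contra! hk0
      have := zpow_le_one_of_nonpos₀ hr1 (by omega : k ≤ 0)
      rw [← hk] at this
      exact absurd this (not_le.2 hs1)
    have := zpow_le_zpow_right₀ hr1 hk0
    rw [← hk, zpow_one] at this
    exact_mod_cast this
  exact le_antisymm (key hr hs h' h) (key hs hr h h')

theorem Contraction.sInvariant_eq {A : Type*} [Group A] [TopologicalSpace A] [IsTopologicalGroup A]
    [LocallyCompactSpace A] (C : Contraction A) : sInvariant A = C.scale := by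
  have h := Nat.sInf_mem (s := {s : ℕ | 2 ≤ s ∧ ModularRangeGeneratedBy A s})
    ⟨_, C.two_le_scale, C.modularRangeGeneratedBy⟩
  exact h.2.unique h.1 C.two_le_scale C.modularRangeGeneratedBy

theorem ModularRangeGeneratedBy.modularRange_eq {G : Type*} [Group G] [TopologicalSpace G]
    [IsTopologicalGroup G] [LocallyCompactSpace G] {s : ℕ} (hs : (s : ℝ≥0) ≠ 0)
    (h : ModularRangeGeneratedBy G s) : modularRange G = Subgroup.zpowers (Units.mk0 _ hs) := by
  ext x
  rw [modularRange, MonoidHom.mem_range, Subgroup.mem_zpowers_iff]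
  simp only [Units.ext_iff, MonoidHom.coe_toHomUnits, Units.val_zpow_eq_zpow_val, Units.val_mk0]
  rw [← Set.mem_range, h]
  simp only [eq_comm]

/-- The coset of `y ^ k` depends only on `k` modulo `b`, since `y ^ b` is a power of `x`. -/
theorem Subgroup.relIndex_zpowers_ne_zero {G : Type*} [Group G] {x y : G} {a b : ℕ} (hb : 1 ≤ b)
    (h : x ^ a = y ^ b) : (Subgroup.zpowers x).relIndex (Subgroup.zpowers y) ≠ 0 := by
  rw [relIndex_eq_ncard]
  have hfin : ((fun g : G => (g : G ⧸ zpowers x)) '' (zpowers y : Set G)).Finite := by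
    refine ((Finset.Ico (0 : ℤ) b).finite_toSet.image
      fun i => ((y ^ i : G) : G ⧸ zpowers x)).subset ?_
    rintro _ ⟨_, ⟨k, rfl⟩, rfl⟩
    refine ⟨k % b, ?_, QuotientGroup.eq.2 ?_⟩
    · rw [SetLike.mem_coe, Finset.mem_Ico]
      exact ⟨Int.emod_nonneg _ (by omega), Int.emod_lt_of_pos _ (by omega)⟩
    · refine ⟨a * (k / b), ?_⟩
      simp only
      rw [zpow_mul, zpow_natCast, h, ← zpow_natCast, ← zpow_mul, ← zpow_neg, ← zpow_add]
      congr 1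
      have := Int.emod_add_mul_ediv k b
      omega
  exact ((Set.ncard_pos hfin).2 ⟨_, 1, one_mem _, rfl⟩).ne'

/-- Modular ranges generated by two integers are commensurable exactly when these have a common
power. -/
theorem commensurable_modularRange_iff {G H : Type*} [Group G] [TopologicalSpace G]
    [IsTopologicalGroup G] [LocallyCompactSpace G] [Group H] [TopologicalSpace H]
    [IsTopologicalGroup H] [LocallyCompactSpace H] {s r : ℕ} (hs : 2 ≤ s) (hr : 2 ≤ r)
    (hG : ModularRangeGeneratedBy G s) (hH : ModularRangeGeneratedBy H r) :
    Subgroup.Commensurable (modularRange G) (modularRange H) ↔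
      ∃ a b : ℕ, 1 ≤ a ∧ 1 ≤ b ∧ s ^ a = r ^ b := by
  have hs0 : (s : ℝ≥0) ≠ 0 := by exact_mod_cast (by omega : s ≠ 0)
  have hr0 : (r : ℝ≥0) ≠ 0 := by exact_mod_cast (by omega : r ≠ 0)
  rw [hG.modularRange_eq hs0, hH.modularRange_eq hr0]
  constructor
  · rintro ⟨-, h⟩
    obtain ⟨a, ha, -, ha'⟩ := Subgroup.exists_pow_mem_of_relIndex_ne_zero h
      (Subgroup.mem_zpowers (Units.mk0 (s : ℝ≥0) hs0))
    obtain ⟨k, hk⟩ := Subgroup.mem_zpowers_iff.1 ha'.1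
    rw [Units.ext_iff, Units.val_zpow_eq_zpow_val, Units.val_pow_eq_pow_val, Units.val_mk0,
      Units.val_mk0] at hk
    -- The exponent is positive because `s ^ a > 1`; this makes the relation one between natural
    -- numbers.
    have hk0 : 0 < k := by
      by_contra! hk0
      have h1 := zpow_le_one_of_nonpos₀ (by exact_mod_cast (by omega : 1 ≤ r) : (1 : ℝ≥0) ≤ r) hk0
      rw [hk] at h1
      exact absurd h1 (not_le.2 (one_lt_pow₀ (by exact_mod_cast (by omega : 1 < s)) (by omega)))
    refine ⟨a, k.toNat, ha, by omega, ?_⟩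
    rw [← Int.toNat_of_nonneg hk0.le, zpow_natCast] at hk
    exact_mod_cast hk.symm
  · rintro ⟨a, b, ha, hb, hab⟩
    have h : Units.mk0 (s : ℝ≥0) hs0 ^ a = Units.mk0 (r : ℝ≥0) hr0 ^ b := by
      rw [Units.ext_iff]
      simp only [Units.val_pow_eq_pow_val, Units.val_mk0]
      exact_mod_cast hab
    exact ⟨Subgroup.relIndex_zpowers_ne_zero hb h, Subgroup.relIndex_zpowers_ne_zero ha h.symm⟩

/-- The least integer `≥ 2` of which `s` is a power. -/
noncomputable def minRoot (s : ℕ) : ℕ := sInf {q : ℕ | 2 ≤ q ∧ ∃ k : ℕ, s = q ^ k}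

theorem minRoot_spec {s : ℕ} (hs : 2 ≤ s) :
    2 ≤ minRoot s ∧ ∃ k : ℕ, 1 ≤ k ∧ s = minRoot s ^ k := by
  obtain ⟨h, k, hk⟩ := Nat.sInf_mem (s := {q : ℕ | 2 ≤ q ∧ ∃ k : ℕ, s = q ^ k})
    ⟨s, hs, 1, (pow_one s).symm⟩
  refine ⟨h, k, Nat.pos_of_ne_zero ?_, hk⟩
  rintro rfl
  rw [pow_zero] at hk
  omega

/-- A root `c` of the minimal root is itself a root of `s`, so it cannot be smaller. -/
theorem minRoot_eq_of_eq_pow {s c k : ℕ} (hs : 2 ≤ s) (h : minRoot s = c ^ k) :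
    c = minRoot s := by
  obtain ⟨h2, j, -, hj⟩ := minRoot_spec hs
  have hk : k ≠ 0 := by
    rintro rfl
    rw [pow_zero] at h
    omega
  have hc2 : 2 ≤ c := by
    by_contra! hc
    interval_cases c
    · rw [zero_pow hk] at h; omega
    · rw [one_pow] at h; omega
  refine le_antisymm ?_ (Nat.sInf_le ⟨hc2, k * j, ?_⟩)
  · rw [h]
    exact Nat.le_self_pow hk c
  · rw [pow_mul, ← h, hj.symm]

theorem isNonPower_minRoot {s : ℕ} (hs : 2 ≤ s) : IsNonPower (minRoot s) := by
  rintro ⟨a, k, -, hlt, h⟩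
  exact hlt.ne (minRoot_eq_of_eq_pow hs h)

theorem minRoot_eq_iff {s r : ℕ} (hs : 2 ≤ s) (hr : 2 ≤ r) :
    minRoot s = minRoot r ↔ ∃ a b : ℕ, 1 ≤ a ∧ 1 ≤ b ∧ s ^ a = r ^ b := by
  obtain ⟨h2, k, hk1, hk⟩ := minRoot_spec hs
  obtain ⟨h2', l, hl1, hl⟩ := minRoot_spec hr
  constructor
  · intro h
    refine ⟨l, k, hl1, hk1, ?_⟩
    rw [h] at hk
    conv_lhs => rw [hk]
    conv_rhs => rw [hl]
    rw [← pow_mul, ← pow_mul, mul_comm]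
  · rintro ⟨a, b, ha, hb, h⟩
    rw [hk, hl, ← pow_mul, ← pow_mul] at h
    -- Integers with a common power are powers of one integer `c`; since neither minimal root is a
    -- proper power, both equal `c`.
    obtain ⟨c, h1, h1'⟩ := Nat.exists_eq_pow_of_pow_eq_pow
      (Or.inl (by positivity : k * a ≠ 0)) h
    rw [← minRoot_eq_of_eq_pow hs h1, ← minRoot_eq_of_eq_pow hr h1']

/-! ### Trees with a parent map -/

/-- The descending rooted-at-infinity tree structure on a set of vertices: a parent map `p` with all
fibres of cardinality `m`, compatible with a height, and such that any two vertices have a common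
ancestor. -/
structure HoroTree (V : Type*) (m : ℕ) where
  /-- The parent map. -/
  p : V → V
  /-- The height. -/
  h : V → ℤ
  h_p : ∀ v, h (p v) = h v + 1
  common : ∀ v w, ∃ a b : ℕ, p^[a] v = p^[b] w
  ncard_fiber : ∀ v, {w | p w = v}.ncard = m

namespace HoroTree

variable {V : Type*} {m : ℕ} (H : HoroTree V m)

theorem h_iterate (v : V) (n : ℕ) : H.h (H.p^[n] v) = H.h v + n := by
  induction n with
  | zero => simp
  | succ n ih => rw [Function.iterate_succ_apply', h_p, ih]; push_cast; ring

theorem common_of_h_eq {v w : V} (hvw : H.h v = H.h w) : ∃ a : ℕ, H.p^[a] v = H.p^[a] w := by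
  obtain ⟨a, b, hab⟩ := H.common v w
  have := congrArg H.h hab
  rw [h_iterate, h_iterate] at this
  obtain rfl : a = b := by omega
  exact ⟨a, hab⟩

/-- The vertices can be labelled bijectively on each fibre, so that a given ray gets the label
`0`. -/
theorem exists_label (hm : 0 < m) (x : V) : ∃ c : V → Fin m,
    (∀ v w, H.p v = H.p w → c v = c w → v = w) ∧ (∀ v i, ∃ w, H.p w = v ∧ c w = i) ∧
      ∀ n, c (H.p^[n] x) = ⟨0, hm⟩ := by
  have key : ∀ v, ∃ e : {w | H.p w = v} ≃ Fin m, ∀ n, ∀ hn : H.p (H.p^[n] x) = v,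
      e ⟨H.p^[n] x, hn⟩ = ⟨0, hm⟩ := by
    intro v
    have hfin : {w | H.p w = v}.Finite := Set.finite_of_ncard_ne_zero (by
      rw [H.ncard_fiber]; omega)
    have := hfin.to_subtype
    let e := Finite.equivFinOfCardEq (H.ncard_fiber v)
    by_cases hv : ∃ n, H.p (H.p^[n] x) = v
    · obtain ⟨n, hn⟩ := hv
      -- By heights, a fibre contains at most one vertex of the ray, so one transposition suffices.
      refine ⟨e.trans (Equiv.swap (e ⟨_, hn⟩) ⟨0, hm⟩), fun k hk => ?_⟩
      have := congrArg H.h (hn.trans hk.symm)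
      rw [h_p, h_p, h_iterate, h_iterate] at this
      obtain rfl : n = k := by omega
      simp
    · exact ⟨e, fun n hn => absurd ⟨n, hn⟩ hv⟩
  choose e he using key
  refine ⟨fun w => e (H.p w) ⟨w, rfl⟩, fun v w hvw h => ?_, fun v i => ?_, fun n => he _ n rfl⟩
  · have : ∀ u, ∀ hu : H.p w = u, e u ⟨w, hu⟩ = e (H.p w) ⟨w, rfl⟩ := by rintro _ rfl; rfl
    simp only at h
    rw [← this _ hvw.symm] at h
    exact congrArg Subtype.val ((e _).injective h)
  · have : ∀ u, ∀ w : {w | H.p w = u}, e (H.p w) ⟨w, rfl⟩ = e u w := by rintro _ ⟨w, rfl⟩; rfl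
    exact ⟨(e v).symm i, ((e v).symm i).2, (this v _).trans (by simp)⟩

/-- The vertices are encoded by their height and the sequence of labels of their ancestors. -/
theorem exists_coding (hm : 0 < m) (x : V) :
    ∃ φ : V ≃ {q : ℤ × (ℕ → Fin m) // ∀ᶠ i in Filter.atTop, q.2 i = ⟨0, hm⟩},
      (φ x).1 = (0, fun _ => ⟨0, hm⟩) ∧
      ∀ v, (φ (H.p v)).1 = ((φ v).1.1 + 1, fun i => (φ v).1.2 (i + 1)) := by
  obtain ⟨c, hinj, hsurj, hc0⟩ := H.exists_label hm x
  let code : V → ℤ × (ℕ → Fin m) := fun v => (H.h v - H.h x, fun i => c (H.p^[i] v))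
  -- The ancestors of `v` eventually merge with those of `x`, all labelled `0`.
  have hcode : ∀ v, ∀ᶠ i in Filter.atTop, (code v).2 i = ⟨0, hm⟩ := fun v => by
    obtain ⟨a, b, hab⟩ := H.common v x
    refine Filter.eventually_atTop.2 ⟨a, fun i hi => ?_⟩
    obtain ⟨j, rfl⟩ := Nat.exists_eq_add_of_le' hi
    change c (H.p^[j + a] v) = _
    rw [Function.iterate_add_apply, hab, ← Function.iterate_add_apply, hc0]
  have hcodeinj : Function.Injective code := fun v w hvw => by
    have h1 : H.h v = H.h w := by
      have : H.h v - H.h x = H.h w - H.h x := congrArg Prod.fst hvw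
      omega
    have h2 : ∀ i, c (H.p^[i] v) = c (H.p^[i] w) := congrFun (congrArg Prod.snd hvw)
    obtain ⟨a, ha⟩ := H.common_of_h_eq h1
    clear hvw h1
    induction a generalizing v w with
    | zero => exact ha
    | succ a ih => exact hinj _ _ (ih _ _ (fun i => h2 (i + 1)) ha) (h2 0)
  -- From a vertex with the `k`-fold shifted code, descend `k` times, each time choosing the child
  -- with the prescribed label.
  have hcodesurj : ∀ k : ℕ, ∀ z : ℤ, ∀ f : ℕ → Fin m,
      (∃ u, code u = (z + k, fun i => f (i + k))) → ∃ v, code v = (z, f) := by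
    intro k
    induction k with
    | zero => rintro z f ⟨u, hu⟩; exact ⟨u, by simpa using hu⟩
    | succ k ih =>
      rintro z f ⟨u, hu⟩
      obtain ⟨w, rfl, hwf⟩ := hsurj u (f k)
      refine ih z f ⟨w, Prod.ext ?_ (funext fun i => ?_)⟩
      · have h1 : H.h (H.p w) - H.h x = z + (k + 1 : ℕ) := congrArg Prod.fst hu
        rw [h_p] at h1
        change H.h w - H.h x = z + k
        push_cast at h1
        omega
      · cases i with
        | zero => simpa [code] using hwf
        | succ i =>
          have h1 : c (H.p^[i] (H.p w)) = f (i + (k + 1)) := congrFun (congrArg Prod.snd hu) i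
          change c (H.p^[i] (H.p w)) = f (i + 1 + k)
          rw [h1]
          congr 1
          omega
  refine ⟨Equiv.ofBijective (fun v => ⟨code v, hcode v⟩)
    ⟨fun v w h => hcodeinj (congrArg Subtype.val h), ?_⟩, ?_, ?_⟩
  · rintro ⟨⟨z, f⟩, hf⟩
    obtain ⟨N, hN⟩ := Filter.eventually_atTop.1 hf
    -- Climbing past `N` leaves only labels `0`, and past `-z` makes the height nonnegative: the
    -- shifted code is that of an ancestor of `x`.
    obtain ⟨v, hv⟩ := hcodesurj (max N (-z).toNat) z f
      ⟨H.p^[(z + max N (-z).toNat).toNat] x, by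
        refine Prod.ext ?_ (funext fun i => ?_)
        · change H.h _ - H.h x = _
          rw [h_iterate, Int.toNat_of_nonneg (by omega)]
          push_cast; ring
        · change c (H.p^[i] _) = f _
          rw [← Function.iterate_add_apply, hc0]
          exact (hN _ (by omega)).symm⟩
    exact ⟨v, Subtype.ext hv⟩
  · exact Prod.ext (sub_self _) (funext hc0)
  · intro v
    refine Prod.ext ?_ rfl
    change H.h (H.p v) - H.h x = H.h v - H.h x + 1
    rw [h_p]; ring

/-- All trees with the same cardinality of the fibres are isomorphic, by an isomorphism with a
prescribed value at one vertex. -/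
theorem exists_equiv {V' : Type*} (H' : HoroTree V' m) (hm : 0 < m) (x : V) (x' : V') :
    ∃ e : V ≃ V', (∀ v, e (H.p v) = H'.p (e v)) ∧ e x = x' := by
  obtain ⟨φ, hφx, hφ⟩ := H.exists_coding hm x
  obtain ⟨φ', hφx', hφ'⟩ := H'.exists_coding hm x'
  refine ⟨φ.trans φ'.symm, fun v => ?_, ?_⟩
  · apply φ'.injective
    apply Subtype.ext
    rw [hφ', Equiv.trans_apply, Equiv.trans_apply, Equiv.apply_symm_apply, Equiv.apply_symm_apply,
      hφ]
  · apply φ'.injective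
    apply Subtype.ext
    rw [hφx', Equiv.trans_apply, Equiv.apply_symm_apply, hφx]

end HoroTree

/-! ### The parent map of a pointed regular tree -/

namespace SimpleGraph

variable {V : Type u} {T : SimpleGraph V}

theorem IsTree.exists_adj_dist_add_one (hT : T.IsTree) {v u : V} (hvu : v ≠ u) :
    ∃ w, T.Adj v w ∧ T.dist w u + 1 = T.dist v u := by
  obtain ⟨p, hp⟩ := hT.connected.exists_walk_length_eq_dist v u
  cases p with
  | nil => exact absurd rfl hvu
  | @cons _ w _ hadj q =>
    refine ⟨w, hadj, ?_⟩
    rw [Walk.length_cons] at hp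
    have h1 := T.dist_le q
    have h2 := hT.dist_eq_dist_add_one_of_adj u hadj
    rw [T.dist_comm (u := w), T.dist_comm (u := v)] at *
    omega

/-- Each such neighbour starts a geodesic from `v` to `u`, and paths in a tree are unique. -/
theorem IsTree.eq_of_adj_of_dist (hT : T.IsTree) {u v w w' : V} (hw : T.Adj v w) (hw' : T.Adj v w')
    (hd : T.dist w u + 1 = T.dist v u) (hd' : T.dist w' u + 1 = T.dist v u) : w = w' := by
  have key : ∀ {w : V} (hw : T.Adj v w), T.dist w u + 1 = T.dist v u →
      ∃ q : T.Walk v u, q.IsPath ∧ q.snd = w := by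
    intro w hw hd
    obtain ⟨q, hq⟩ := hT.connected.exists_walk_length_eq_dist w u
    refine ⟨Walk.cons hw q, Walk.isPath_of_length_eq_dist _ ?_, by simp⟩
    rw [Walk.length_cons, hq, hd]
  obtain ⟨q, hq, rfl⟩ := key hw hd
  obtain ⟨q', hq', rfl⟩ := key hw' hd'
  rw [(hT.existsUnique_path v u).unique hq hq']

theorem Iso.dist_eq_dist {V' : Type*} {T' : SimpleGraph V'} (g : T ≃g T') (hT : T.Connected)
    (v w : V) : T'.dist (g v) (g w) = T.dist v w := by
  apply le_antisymm
  · obtain ⟨q, hq⟩ := hT.exists_walk_length_eq_dist v w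
    rw [← hq, ← Walk.length_map g.toHom q]
    exact dist_le _
  · obtain ⟨q, hq⟩ := (g.connected_iff.1 hT).exists_walk_length_eq_dist (g v) (g w)
    rw [← hq, ← Walk.length_map g.symm.toHom q]
    have h := dist_le (q.map g.symm.toHom)
    simpa using h

end SimpleGraph

namespace TreeRay

variable {V : Type u} {T : SimpleGraph V} (r : TreeRay T)

/-- If the distance to `v` rose and then fell, the vertices before and after the peak would both be
its neighbour towards `v`, contradicting injectivity of the ray. -/
theorem dist_succ_of_dist_succ (hT : T.IsTree) {v : V} {n : ℕ}
    (h : T.dist v (r.vertex (n + 1)) = T.dist v (r.vertex n) + 1) :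
    ∀ k, T.dist v (r.vertex (n + k)) = T.dist v (r.vertex n) + k := by
  have hstep : ∀ k, T.dist v (r.vertex (n + k + 1)) = T.dist v (r.vertex (n + k)) + 1 := by
    intro k
    induction k with
    | zero => exact h
    | succ k ih =>
      rcases hT.dist_eq_dist_add_one_of_adj v (r.adj (n + (k + 1))) with h1 | h1
      · have := hT.eq_of_adj_of_dist (r.adj (n + (k + 1))) (r.adj (n + k)).symm (u := v)
          (by rw [T.dist_comm, T.dist_comm (v := v)]; exact h1.symm)
          (by rw [T.dist_comm, T.dist_comm (v := v)]; exact ih.symm)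
        have := r.injective this
        omega
      · exact h1
  intro k
  induction k with
  | zero => rfl
  | succ k ih => rw [← add_assoc, hstep, ih, add_assoc]

/-- The distance to the vertices of a ray eventually increases at unit speed. -/
theorem exists_dist_eq (hT : T.IsTree) (v : V) : ∃ n, ∀ k, T.dist v (r.vertex (n + k)) =
    T.dist v (r.vertex n) + k := by
  by_cases h : ∃ n, T.dist v (r.vertex (n + 1)) = T.dist v (r.vertex n) + 1
  · obtain ⟨n, hn⟩ := h
    exact ⟨n, r.dist_succ_of_dist_succ hT hn⟩
  · push Not at h
    exfalso
    have key : ∀ n, T.dist v (r.vertex n) + n = T.dist v (r.vertex 0) := by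
      intro n
      induction n with
      | zero => rfl
      | succ n ih =>
        have := hT.dist_eq_dist_add_one_of_adj v (r.adj n)
        have := h n
        omega
    have := key (T.dist v (r.vertex 0) + 1)
    omega

theorem dist_vertex_add (hT : T.IsTree) (n k : ℕ) : T.dist (r.vertex n) (r.vertex (n + k)) = k := by
  have := r.dist_succ_of_dist_succ hT (v := r.vertex n) (n := n)
    (by rw [SimpleGraph.dist_self, SimpleGraph.dist_eq_one_iff_adj.2 (r.adj n)]) k
  rwa [SimpleGraph.dist_self, zero_add] at this

/-- The vertex `w` is the neighbour of `v` in the direction of the ray. -/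
def IsParent (v w : V) : Prop :=
  T.Adj v w ∧ ∀ᶠ n in Filter.atTop, T.dist w (r.vertex n) + 1 = T.dist v (r.vertex n)

/-- The triangle inequality through `r n` shows that `w` is strictly closer than `v` to later
vertices, and adjacent vertices have distances differing by exactly one. -/
theorem isParent_of_dist (hT : T.IsTree) {v w : V} {n : ℕ}
    (hn : ∀ k, T.dist v (r.vertex (n + k)) = T.dist v (r.vertex n) + k) (hvw : T.Adj v w)
    (h : T.dist w (r.vertex n) + 1 = T.dist v (r.vertex n)) :
    ∀ k, T.dist w (r.vertex (n + k)) + 1 = T.dist v (r.vertex (n + k)) := by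
  intro k
  have h1 := hT.dist_eq_dist_add_one_of_adj (r.vertex (n + k)) hvw
  have h2 := hT.connected.dist_triangle (u := w) (v := r.vertex n) (w := r.vertex (n + k))
  have h3 := hn k
  rw [r.dist_vertex_add hT] at h2
  rw [T.dist_comm (v := v), T.dist_comm (v := w)] at h1
  omega

theorem isParent_of_dist' (hT : T.IsTree) {v w : V} {n : ℕ}
    (hn : ∀ k, T.dist v (r.vertex (n + k)) = T.dist v (r.vertex n) + k) (hvw : T.Adj v w)
    (h : T.dist w (r.vertex n) + 1 = T.dist v (r.vertex n)) : r.IsParent v w :=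
  ⟨hvw, Filter.eventually_atTop.2 ⟨n, fun k hk => by
    obtain ⟨k, rfl⟩ := Nat.exists_eq_add_of_le hk
    exact r.isParent_of_dist hT hn hvw h k⟩⟩

theorem exists_isParent (hT : T.IsTree) (v : V) : ∃ w, r.IsParent v w := by
  obtain ⟨n, hn⟩ := r.exists_dist_eq hT v
  -- Passing to `n + 1` ensures that the target differs from `v`.
  have hn' : ∀ k, T.dist v (r.vertex (n + 1 + k)) = T.dist v (r.vertex (n + 1)) + k := fun k => by
    rw [hn 1, add_assoc, hn]; omega
  have hne : v ≠ r.vertex (n + 1) := by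
    intro h
    have := hn 1
    rw [← h, SimpleGraph.dist_self] at this
    omega
  obtain ⟨w, hw, hd⟩ := hT.exists_adj_dist_add_one hne
  exact ⟨w, r.isParent_of_dist' hT hn' hw hd⟩

theorem IsParent.unique {r : TreeRay T} (hT : T.IsTree) {v w w' : V} (h : r.IsParent v w) (h' : r.IsParent v w') : w = w' := by
  obtain ⟨n, hn, hn'⟩ := (h.2.and h'.2).exists
  exact hT.eq_of_adj_of_dist h.1 h'.1 hn hn'

theorem isParent_vertex (hT : T.IsTree) (n : ℕ) : r.IsParent (r.vertex n) (r.vertex (n + 1)) :=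
  ⟨r.adj n, Filter.eventually_atTop.2 ⟨n + 1, fun k hk => by
    obtain ⟨k, rfl⟩ := Nat.exists_eq_add_of_le hk
    rw [r.dist_vertex_add hT, add_assoc, r.dist_vertex_add hT, add_comm]⟩⟩

/-- The horofunction of a ray. -/
theorem exists_height (hT : T.IsTree) : ∃ h : V → ℤ, ∀ v, ∀ᶠ n : ℕ in Filter.atTop,
    (n : ℤ) - T.dist v (r.vertex n) = h v := by
  choose n hn using r.exists_dist_eq hT
  refine ⟨fun v => n v - T.dist v (r.vertex (n v)), fun v => Filter.eventually_atTop.2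
    ⟨n v, fun k hk => ?_⟩⟩
  obtain ⟨k, rfl⟩ := Nat.exists_eq_add_of_le hk
  rw [hn]
  push_cast; ring

/-- The tree with its parent map in the direction of a ray. -/
theorem exists_horoTree (hT : T.IsTree) {m : ℕ}
    (hreg : ∀ v, (T.neighborSet v).ncard = m + 1) :
    ∃ H : HoroTree V m, ∀ v, r.IsParent v (H.p v) := by
  choose p hp using r.exists_isParent hT
  obtain ⟨h, hh⟩ := r.exists_height hT
  have hhp : ∀ v, h (p v) = h v + 1 := fun v => by
    obtain ⟨n, h1, h2, h3⟩ := ((hh v).and ((hh (p v)).and (hp v).2)).exists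
    omega
  have hpv : ∀ n, p (r.vertex n) = r.vertex (n + 1) := fun n =>
    (hp _).unique hT (r.isParent_vertex hT n)
  have hpk : ∀ k n, p^[k] (r.vertex n) = r.vertex (n + k) := fun k n => by
    induction k with
    | zero => rfl
    | succ k ih => rw [Function.iterate_succ_apply', ih, hpv, add_assoc]
  have hanc : ∀ n d v, (∀ k, T.dist v (r.vertex (n + k)) = T.dist v (r.vertex n) + k) →
      T.dist v (r.vertex n) = d → p^[d] v = r.vertex n := by
    intro n d
    induction d with
    | zero => intro v _ hv; exact hT.connected.dist_eq_zero_iff.1 hv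
    | succ d ih =>
      intro v hn hv
      have hne : v ≠ r.vertex n := by
        rintro rfl
        rw [SimpleGraph.dist_self] at hv
        omega
      obtain ⟨w, hw, hd⟩ := hT.exists_adj_dist_add_one hne
      obtain rfl := (hp v).unique hT (r.isParent_of_dist' hT hn hw hd)
      refine ih _ (fun k => ?_) (by omega)
      have := r.isParent_of_dist hT hn hw hd k
      have := hn k
      omega
  -- Adjacent vertices have heights differing by one, and the higher is the parent of the lower.
  have hadj : ∀ v w, T.Adj v w → w ≠ p v → p w = v := fun v w hvw hne => by
    have hlt : h w = h v + 1 ∨ h w + 1 = h v := by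
      obtain ⟨n, h1, h2⟩ := ((hh v).and (hh w)).exists
      have h3 := hT.dist_eq_dist_add_one_of_adj (r.vertex n) hvw
      rw [T.dist_comm (v := v), T.dist_comm (v := w)] at h3
      omega
    rcases hlt with hlt | hlt
    · refine absurd ((hp v).unique hT ⟨hvw, ?_⟩) hne.symm
      filter_upwards [hh v, hh w] with n h1 h2
      omega
    · refine (hp w).unique hT ⟨hvw.symm, ?_⟩
      filter_upwards [hh v, hh w] with n h1 h2
      omega
  refine ⟨{ p := p, h := h, h_p := hhp, common := fun v w => ?_, ncard_fiber := fun v => ?_ }, hp⟩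
  · obtain ⟨n, hn⟩ := r.exists_dist_eq hT v
    obtain ⟨n', hn'⟩ := r.exists_dist_eq hT w
    refine ⟨n' + T.dist v (r.vertex n), n + T.dist w (r.vertex n'), ?_⟩
    rw [Function.iterate_add_apply, Function.iterate_add_apply, hanc n _ v hn rfl,
      hanc n' _ w hn' rfl, hpk, hpk, add_comm]
  · have hset : T.neighborSet v = insert (p v) {w | p w = v} := by
      ext w
      rw [SimpleGraph.mem_neighborSet, Set.mem_insert_iff]
      constructor
      · intro hw
        by_cases hwp : w = p v
        · exact Or.inl hwp
        · exact Or.inr (hadj v w hw hwp)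
      · rintro (rfl | rfl)
        · exact (hp v).1
        · exact (hp w).1.symm
    have hnot : p v ∉ {w | p w = v} := fun hv => by
      have h1 := congrArg h (show p (p v) = v from hv)
      rw [hhp, hhp] at h1
      omega
    have hfin : (T.neighborSet v).Finite := Set.finite_of_ncard_ne_zero (by rw [hreg]; omega)
    have h1 := hreg v
    rw [hset] at h1 hfin
    rw [Set.ncard_insert_of_notMem hnot (hfin.subset (Set.subset_insert _ _))] at h1
    omega

end TreeRay

/-! ### The groups `FT_m` -/

namespace PointedRegularTree

variable {m : ℕ} (X : PointedRegularTree.{u} m)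

/-- A ray towards the boundary point. -/
noncomputable def ray : TreeRay X.T := Quotient.out X.ω

/-- The parent map towards the boundary point. -/
noncomputable def horoTree : HoroTree X.V m :=
  (X.ray.exists_horoTree X.isTree X.regular).choose

theorem isParent (v : X.V) : X.ray.IsParent v (X.horoTree.p v) :=
  (X.ray.exists_horoTree X.isTree X.regular).choose_spec v

theorem ω_eq : X.ω = Quotient.mk (TreeRay.setoid X.T) X.ray := (Quotient.out_eq X.ω).symm

theorem p_iterate_ray (n k : ℕ) : X.horoTree.p^[k] (X.ray.vertex n) = X.ray.vertex (n + k) := by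
  induction k with
  | zero => rfl
  | succ k ih =>
    rw [Function.iterate_succ_apply', ih]
    exact (X.isParent _).unique X.isTree (X.ray.isParent_vertex X.isTree _)

/-- The parent and the `m` children are `m + 1` distinct neighbours, so there are no others. -/
theorem adj_iff {v w : X.V} : X.T.Adj v w ↔ X.horoTree.p v = w ∨ X.horoTree.p w = v := by
  constructor
  · intro h
    by_contra! hne
    have hset : insert (X.horoTree.p v) {w | X.horoTree.p w = v} ⊆ X.T.neighborSet v := by
      rintro u (rfl | rfl)
      · exact (X.isParent v).1
      · exact (X.isParent u).1.symm
    have hfin : (X.T.neighborSet v).Finite := Set.finite_of_ncard_ne_zero (by rw [X.regular]; omega)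
    have hnot : X.horoTree.p v ∉ {w | X.horoTree.p w = v} := fun hv => by
      have h1 := congrArg X.horoTree.h (show X.horoTree.p (X.horoTree.p v) = v from hv)
      rw [X.horoTree.h_p, X.horoTree.h_p] at h1
      omega
    have heq := Set.eq_of_subset_of_ncard_le hset (by
      rw [X.regular, Set.ncard_insert_of_notMem hnot (hfin.subset
        ((Set.subset_insert _ _).trans hset)), X.horoTree.ncard_fiber]) hfin
    have hw : w ∈ insert (X.horoTree.p v) {w | X.horoTree.p w = v} := by rw [heq]; exact h
    rcases hw with rfl | hw
    · exact hne.1 rfl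
    · exact hne.2 hw
  · rintro (rfl | rfl)
    · exact (X.isParent v).1
    · exact (X.isParent w).1.symm

/-- An automorphism fixes the boundary point if and only if it commutes with the parent map. -/
theorem mem_stabilizer_iff {g : X.T ≃g X.T} :
    g ∈ MulAction.stabilizer (X.T ≃g X.T) X.ω ↔
      ∀ v, g (X.horoTree.p v) = X.horoTree.p (g v) := by
  have hiff : g ∈ MulAction.stabilizer (X.T ≃g X.T) X.ω ↔
      ∃ a b : ℕ, ∀ n, g (X.ray.vertex (n + a)) = X.ray.vertex (n + b) := by
    rw [MulAction.mem_stabilizer_iff, ω_eq]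
    exact Quotient.eq (r := TreeRay.setoid X.T) (x := TreeRay.map g X.ray)
  rw [hiff]
  constructor
  · rintro ⟨a, b, hab⟩ v
    refine (X.isParent (g v)).unique X.isTree ⟨g.map_adj_iff.2 (X.isParent v).1, ?_⟩ |>.symm
    obtain ⟨N, hN⟩ := Filter.eventually_atTop.1 (X.isParent v).2
    refine Filter.eventually_atTop.2 ⟨N + b, fun k hk => ?_⟩
    obtain ⟨j, rfl⟩ := Nat.exists_eq_add_of_le' hk
    rw [← add_assoc, ← hab, g.dist_eq_dist X.isTree.connected, g.dist_eq_dist X.isTree.connected]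
    exact hN _ (by omega)
  · intro hg
    have hgk : ∀ k v, g (X.horoTree.p^[k] v) = X.horoTree.p^[k] (g v) := fun k v =>
      (Function.Commute.iterate_right (f := g) (g := X.horoTree.p) hg k) v
    obtain ⟨a, b, hab⟩ := X.horoTree.common (g (X.ray.vertex 0)) (X.ray.vertex 0)
    refine ⟨a, b, fun n => ?_⟩
    have h1 := X.p_iterate_ray 0 (n + a)
    have h2 := X.p_iterate_ray 0 (n + b)
    rw [zero_add] at h1 h2
    rw [← h1, ← h2, hgk, Function.iterate_add_apply, hab, ← Function.iterate_add_apply]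

theorem apply_p (g : FT X) (v : X.V) : g.1 (X.horoTree.p v) = X.horoTree.p (g.1 v) :=
  X.mem_stabilizer_iff.1 g.2 v

theorem apply_p_iterate (g : FT X) (k : ℕ) (v : X.V) :
    g.1 (X.horoTree.p^[k] v) = X.horoTree.p^[k] (g.1 v) :=
  (Function.Commute.iterate_right (f := g.1) (g := X.horoTree.p) (X.apply_p g) k) v

/-- The element of `FT_m` given by a permutation commuting with the parent map. -/
noncomputable def ofEquiv (e : X.V ≃ X.V) (he : ∀ v, e (X.horoTree.p v) = X.horoTree.p (e v)) : FT X :=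
  ⟨{ e with
      map_rel_iff' := fun {v w} => by
        rw [adj_iff, adj_iff, ← he, ← he, e.injective.eq_iff, e.injective.eq_iff] },
    X.mem_stabilizer_iff.2 he⟩

theorem mul_apply (g h : FT X) (v : X.V) : (g * h).1 v = g.1 (h.1 v) := rfl

theorem one_apply (v : X.V) : (1 : FT X).1 v = v := rfl

theorem inv_apply_apply (g : FT X) (v : X.V) : g⁻¹.1 (g.1 v) = v := by
  rw [← mul_apply, inv_mul_cancel, one_apply]

theorem apply_inv_apply (g : FT X) (v : X.V) : g.1 (g⁻¹.1 v) = v := by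
  rw [← mul_apply, mul_inv_cancel, one_apply]

theorem ext {g h : FT X} (hgh : ∀ v, g.1 v = h.1 v) : g = h :=
  Subtype.ext (RelIso.ext hgh)

/-- Transitivity on vertices is the uniqueness of the tree with a base vertex, applied to the tree
and itself. -/
theorem exists_apply_eq (hm : 0 < m) (v w : X.V) : ∃ g : FT X, g.1 v = w := by
  obtain ⟨e, he, hv⟩ := X.horoTree.exists_equiv X.horoTree hm v w
  exact ⟨X.ofEquiv e he, hv⟩

theorem isOpen_setOf_apply_eq (v w : X.V) : IsOpen {g : FT X | g.1 v = w} :=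
  (SimpleGraph.isOpen_aut X.T v w).preimage continuous_subtype_val

theorem continuous_iff {A : Type*} [TopologicalSpace A] {f : A → FT X} :
    Continuous f ↔ ∀ v w : X.V, IsOpen {x | (f x).1 v = w} := by
  exact continuous_induced_rng.trans (SimpleGraph.continuous_aut_iff X.T)

theorem nhds_le {F : Filter (FT X)} {g : FT X} (h : ∀ v, ∀ᶠ x in F, x.1 v = g.1 v) :
    F ≤ 𝓝 g := by
  let _ : TopologicalSpace X.V := ⊥
  have : DiscreteTopology X.V := ⟨rfl⟩
  have hind : Topology.IsInducing (fun g : FT X => (fun v => g.1 v : X.V → X.V)) :=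
    Topology.IsInducing.comp (g := fun (g : X.T ≃g X.T) v => g v) ⟨rfl⟩
      Topology.IsInducing.subtypeVal
  rw [hind.nhds_eq_comap, ← Filter.tendsto_iff_comap, tendsto_pi_nhds]
  intro v
  rw [nhds_discrete, Filter.tendsto_pure]
  exact h v

instance t2Space : T2Space (FT X) := by
  refine ⟨fun g h hgh => ?_⟩
  obtain ⟨v, hv⟩ : ∃ v, g.1 v ≠ h.1 v := by
    by_contra! hcon
    exact hgh (X.ext hcon)
  refine ⟨_, _, X.isOpen_setOf_apply_eq v (g.1 v), X.isOpen_setOf_apply_eq v (h.1 v), rfl, rfl, ?_⟩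
  rw [Set.disjoint_left]
  intro x hx hx'
  exact hv (hx.symm.trans hx')

/-- The stabilizer of a vertex. -/
def stab (v : X.V) : Subgroup (FT X) where
  carrier := {g | g.1 v = v}
  mul_mem' := fun {g h} hg hh => by
    change (g * h).1 v = v
    rw [mul_apply, show h.1 v = v from hh]
    exact hg
  one_mem' := rfl
  inv_mem' := fun {g} hg => by
    have := X.inv_apply_apply g v
    rwa [show g.1 v = v from hg] at this

theorem mem_stab {v : X.V} {g : FT X} : g ∈ X.stab v ↔ g.1 v = v := Iff.rfl

theorem isOpen_stab (v : X.V) : IsOpen (X.stab v : Set (FT X)) := X.isOpen_setOf_apply_eq v v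

theorem finite_fiber_iterate (hm : 0 < m) (k : ℕ) (v : X.V) :
    {w | X.horoTree.p^[k] w = v}.Finite := by
  induction k with
  | zero => exact Set.finite_singleton v |>.subset fun w hw => hw
  | succ k ih =>
    have : {w | X.horoTree.p^[k + 1] w = v} =
        ⋃ u ∈ {u | X.horoTree.p^[k] u = v}, {w | X.horoTree.p w = u} := by
      ext w
      simp
    rw [this]
    exact ih.biUnion fun u _ => Set.finite_of_ncard_ne_zero (by
      rw [X.horoTree.ncard_fiber]; omega)

/-- An element fixing `v₀` fixes its ancestors, so each vertex has finitely many possible images.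
Along an ultrafilter the elements and their inverses therefore converge pointwise, and the two
limits are mutually inverse. -/
theorem isCompact_stab (hm : 0 < m) (v₀ : X.V) : IsCompact (X.stab v₀ : Set (FT X)) := by
  rw [isCompact_iff_ultrafilter_le_nhds]
  intro F hF
  have hstab : ∀ᶠ g in (F : Filter (FT X)), g ∈ X.stab v₀ := Filter.le_principal_iff.1 hF
  have hfix : ∀ v, ∃ S : Set X.V, S.Finite ∧ ∀ g ∈ X.stab v₀, g.1 v ∈ S := fun v => by
    obtain ⟨a, b, hab⟩ := X.horoTree.common v v₀
    refine ⟨_, X.finite_fiber_iterate hm a (X.horoTree.p^[b] v₀), fun g hg => ?_⟩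
    rw [Set.mem_ofPred_eq, ← X.apply_p_iterate, hab, X.apply_p_iterate, hg]
  have hlim : ∀ f : FT X → FT X, (∀ g ∈ X.stab v₀, f g ∈ X.stab v₀) → ∀ v, ∃ w,
      ∀ᶠ g in (F : Filter (FT X)), (f g).1 v = w := fun f hf v => by
    obtain ⟨S, hS, hgS⟩ := hfix v
    have h1 : ∀ᶠ g in (F : Filter (FT X)), ∃ w ∈ S, (f g).1 v = w := by
      filter_upwards [hstab] with g hg
      exact ⟨_, hgS _ (hf g hg), rfl⟩
    obtain ⟨w, -, hw⟩ := (Ultrafilter.eventually_exists_mem_iff hS).1 h1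
    exact ⟨w, hw⟩
  choose a ha using hlim id fun g hg => hg
  choose b hb using hlim (fun g => g⁻¹) fun g hg => inv_mem hg
  let e : X.V ≃ X.V :=
    { toFun := a
      invFun := b
      left_inv := fun v => by
        obtain ⟨g, h1, h2⟩ := ((ha v).and (hb (a v))).exists
        rw [← h2, ← h1]
        exact X.inv_apply_apply g v
      right_inv := fun v => by
        obtain ⟨g, h1, h2⟩ := ((hb v).and (ha (b v))).exists
        rw [← h2, ← h1]
        exact X.apply_inv_apply g v }
  have he : ∀ v, e (X.horoTree.p v) = X.horoTree.p (e v) := fun v => by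
    obtain ⟨g, h1, h2⟩ := ((ha v).and (ha (X.horoTree.p v))).exists
    change a _ = X.horoTree.p (a v)
    rw [← h1, ← h2]
    exact X.apply_p g v
  refine ⟨X.ofEquiv e he, ?_, X.nhds_le fun v => ha v⟩
  obtain ⟨g, h1, h2⟩ := ((ha v₀).and hstab).exists
  change a v₀ = v₀
  rw [← h1]
  exact h2

/-- Commuting with the parent map forces a constant height shift, compared at a common ancestor. -/
theorem h_apply_sub (g : FT X) (v w : X.V) :
    X.horoTree.h v - X.horoTree.h (g.1 v) = X.horoTree.h w - X.horoTree.h (g.1 w) := by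
  obtain ⟨a, b, hab⟩ := X.horoTree.common v w
  have h1 := congrArg X.horoTree.h hab
  have h2 := congrArg (fun u => X.horoTree.h (g.1 u)) hab
  simp only [X.apply_p_iterate, HoroTree.h_iterate] at h1 h2
  omega

/-- The Busemann character. -/
noncomputable def busemann : FT X →* Multiplicative ℤ where
  toFun g := Multiplicative.ofAdd
    (X.horoTree.h (X.ray.vertex 0) - X.horoTree.h (g.1 (X.ray.vertex 0)))
  map_one' := by simp [one_apply]
  map_mul' g h := by
    rw [← ofAdd_add, mul_apply, X.h_apply_sub g _ (h.1 (X.ray.vertex 0))]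
    congr 1
    ring

theorem toAdd_busemann (g : FT X) (v : X.V) :
    (X.busemann g).toAdd = X.horoTree.h v - X.horoTree.h (g.1 v) :=
  X.h_apply_sub g _ _

theorem exists_child (hm : 0 < m) (v : X.V) : ∃ w, X.horoTree.p w = v := by
  have := X.horoTree.ncard_fiber v
  exact Set.nonempty_of_ncard_ne_zero (s := {w | X.horoTree.p w = v}) (by omega)

/-- The contraction of `FT_m` defined by an element which sends a vertex to one of its children. -/
theorem exists_contraction (hm : 2 ≤ m) (v₀ : X.V) :
    ∃ C : Contraction (FT X), C.scale = m := by
  have hm0 : 0 < m := by omega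
  obtain ⟨w₀, hw₀⟩ := X.exists_child hm0 v₀
  obtain ⟨t, ht⟩ := X.exists_apply_eq hm0 v₀ w₀
  have htk : ∀ k : ℕ, (t ^ k).1 (X.horoTree.p^[k] v₀) = v₀ := fun k => by
    induction k with
    | zero => rfl
    | succ k ih =>
      rw [pow_succ, mul_apply, Function.iterate_succ_apply', X.apply_p, X.apply_p_iterate, ht,
        ← Function.iterate_succ_apply' X.horoTree.p, Function.iterate_succ_apply, hw₀, ih]
  have htk' : ∀ k : ℕ, (t ^ k)⁻¹.1 v₀ = X.horoTree.p^[k] v₀ := fun k => by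
    conv_lhs => rw [← htk k]
    exact X.inv_apply_apply _ _
  have hconj : ∀ g : FT X, t⁻¹ * g * t ∈ X.stab v₀ ↔ g ∈ X.stab w₀ := fun g => by
    rw [mem_stab, mem_stab, mul_apply, mul_apply, ht]
    constructor
    · intro h
      rw [← X.apply_inv_apply t (g.1 w₀), h, ht]
    · intro h
      rw [h, ← ht, X.inv_apply_apply]
  have hle : X.stab w₀ ≤ X.stab v₀ := fun g hg => by
    rw [mem_stab, ← hw₀, X.apply_p, hg]
  -- The stabilizer of `v₀` permutes its `m` children transitively, and `stab w₀` is the stabilizer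
  -- of one of them.
  have hrel : (X.stab w₀).relIndex (X.stab v₀) = m := by
    refine (Subgroup.relIndex_eq_ncard_image (f := fun g : FT X => g.1 w₀) fun g h => ?_).trans
      ((congrArg Set.ncard (Set.ext fun w => ?_)).trans (X.horoTree.ncard_fiber v₀))
    · rw [mem_stab, mul_apply]
      constructor
      · intro hgh
        rw [← hgh, X.inv_apply_apply]
      · intro hgh
        rw [← X.apply_inv_apply g (h.1 w₀), hgh]
    · constructor
      · rintro ⟨g, hg, rfl⟩
        rw [Set.mem_ofPred_eq, ← X.apply_p, hw₀, hg]
      · intro hw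
        obtain ⟨g, hg⟩ := X.exists_apply_eq hm0 w₀ w
        refine ⟨g, ?_, hg⟩
        rw [SetLike.mem_coe, mem_stab, ← hw₀, X.apply_p, hg, hw, hw₀]
  let C : Contraction (FT X) :=
    { χ := X.busemann
      U := X.stab v₀
      t := t
      isOpen := X.isOpen_stab v₀
      isCompact := X.isCompact_stab hm0 v₀
      U_le := fun g hg => by
        change (X.busemann g).toAdd = 0
        rw [X.toAdd_busemann g v₀, hg, sub_self]
      χ_t := by
        change (X.busemann t).toAdd = 1
        rw [X.toAdd_busemann t v₀, ht, ← hw₀, HoroTree.h_p]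
        ring
      conj_mem := fun g hg => hle ((hconj _).1 (by
        have : t⁻¹ * (t * g * t⁻¹) * t = g := by group
        rwa [this]))
      absorb := fun g hg => by
        have h1 : X.horoTree.h v₀ = X.horoTree.h (g.1 v₀) := by
          have h2 : (X.busemann g).toAdd = 0 := hg
          rw [X.toAdd_busemann g v₀] at h2
          omega
        obtain ⟨k, hk⟩ := X.horoTree.common_of_h_eq h1
        refine ⟨k, ?_⟩
        rw [mem_stab, mul_apply, mul_apply, htk', X.apply_p_iterate, ← hk, htk]
      proper := by
        by_contra! hcon
        have : X.stab v₀ ≤ X.stab w₀ := fun g hg => (hconj g).1 (hcon g hg)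
        rw [Subgroup.relIndex_eq_one.2 this] at hrel
        omega }
  refine ⟨C, ?_⟩
  have h1 : C.level (-1) = X.stab w₀ := by
    ext g
    rw [Contraction.mem_level, zpow_neg_one, inv_inv]
    exact hconj g
  rw [Contraction.scale, h1, Contraction.level_zero]
  exact hrel

end PointedRegularTree

/-! ### The tree of a contraction -/

namespace Contraction

section

variable {A : Type*} [Group A] [TopologicalSpace A] (C : Contraction A)

/-- The parent map on the cosets of `U`. -/
def parent : A ⧸ C.U → A ⧸ C.U :=
  Quotient.map' (fun g => g * C.t⁻¹) fun a b hab => by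
    rw [QuotientGroup.leftRel_apply] at hab ⊢
    have := C.conj_mem _ hab
    convert! this using 1
    group

theorem parent_mk (g : A) : C.parent (g : A ⧸ C.U) = ((g * C.t⁻¹ : A) : A ⧸ C.U) := rfl

theorem parent_iterate_mk (g : A) (n : ℕ) :
    C.parent^[n] (g : A ⧸ C.U) = ((g * (C.t ^ n)⁻¹ : A) : A ⧸ C.U) := by
  induction n with
  | zero => simp
  | succ n ih =>
    rw [Function.iterate_succ_apply', ih, parent_mk, pow_succ', mul_inv_rev, mul_assoc]

theorem parent_smul (g : A) (v : A ⧸ C.U) : C.parent (g • v) = g • C.parent v := by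
  induction v using QuotientGroup.induction_on with
  | H a =>
    change ((g * a * C.t⁻¹ : A) : A ⧸ C.U) = ((g * (a * C.t⁻¹) : A) : A ⧸ C.U)
    rw [mul_assoc]

/-- The cosets of `U` form a tree with parent map. -/
def horoTree : HoroTree (A ⧸ C.U) C.scale where
  p := C.parent
  h := Quotient.lift (fun g => -(C.χ g).toAdd) fun a b hab => by
    have h1 := C.U_le (QuotientGroup.leftRel_apply.1 hab)
    rw [MonoidHom.mem_ker, map_mul, map_inv, inv_mul_eq_one] at h1
    rw [h1]
  h_p v := by
    induction v using QuotientGroup.induction_on with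
    | H a =>
      change -(C.χ (a * C.t⁻¹)).toAdd = -(C.χ a).toAdd + 1
      rw [map_mul, map_inv, C.χ_t, toAdd_mul, toAdd_inv, toAdd_ofAdd]
      ring
  common v w := by
    induction v using QuotientGroup.induction_on with
    | H a =>
      induction w using QuotientGroup.induction_on with
      | H b =>
        obtain ⟨k, hk⟩ := C.exists_mem_level (C.mul_zpow_mem_ker (a⁻¹ * b))
        set c := (C.χ (a⁻¹ * b)).toAdd with hc
        have hk' := C.level_mono (by omega : (k : ℤ) ≤ (k + c.natAbs : ℕ)) hk
        -- The two exponents differ by `c`, the height difference; adding `|c|` keeps the second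
        -- nonnegative, and `k` puts the kernel part of `a⁻¹ b` in the level.
        refine ⟨k + c.natAbs, (k + c.natAbs + c).toNat, ?_⟩
        rw [parent_iterate_mk, parent_iterate_mk, QuotientGroup.eq, ← zpow_natCast,
          ← zpow_natCast, Int.toNat_of_nonneg (by omega), zpow_add]
        rw [mem_level] at hk'
        convert! hk' using 1
        push_cast
        group
  ncard_fiber v := by
    induction v using QuotientGroup.induction_on with
    | H a =>
      -- The children of `a U` are the cosets `a u t U` with `u ∈ U`, distinguished by the class of
      -- `u` modulo `t U t⁻¹`.
      rw [scale, Subgroup.relIndex_eq_ncard_image (f := fun u : A => ((a * u * C.t : A) : A ⧸ C.U))]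
      · congr 1
        ext w
        induction w using QuotientGroup.induction_on with
        | H b =>
          rw [Set.mem_ofPred_eq, parent_mk, QuotientGroup.eq, level_zero]
          constructor
          · intro h
            refine ⟨a⁻¹ * b * C.t⁻¹, ?_, ?_⟩
            · have := inv_mem h
              convert! this using 1
              group
            · simp only
              congr 1
              group
          · rintro ⟨u, hu, h⟩
            have h1 := C.conj_mem _ (QuotientGroup.eq.1 h)
            have h2 := inv_mem (mul_mem hu h1)
            convert! h2 using 1
            group
      · intro b c
        rw [QuotientGroup.eq, mem_level, zpow_neg_one, inv_inv]
        congr! 1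
        group

end

/-- A group with a contraction of scale `m` acts properly and vertex-transitively on an
`(m + 1)`-regular tree, fixing a boundary point. -/
theorem copci_FT {A : TopGroup.{u}} (C : Contraction A) {m : ℕ} (hm : C.scale = m)
    (X : PointedRegularTree.{u} m) : Copci A (FT X) := by
  subst hm
  obtain ⟨e, he, -⟩ := C.horoTree.exists_equiv X.horoTree C.scale_ne_zero.bot_lt
    ((1 : A) : A ⧸ C.U) (X.ray.vertex 0)
  have he' : ∀ v, e.symm (X.horoTree.p v) = C.parent (e.symm v) := fun v => by
    apply e.injective
    rw [Equiv.apply_symm_apply]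
    exact ((he _).trans (by rw [Equiv.apply_symm_apply])).symm
  let f : A →* FT X :=
    { toFun := fun g => X.ofEquiv ((e.symm.trans (MulAction.toPerm g)).trans e) fun v => by
        change e (g • e.symm (X.horoTree.p v)) = X.horoTree.p (e (g • e.symm v))
        rw [he', ← he]
        exact congrArg e (C.parent_smul g _).symm
      map_one' := X.ext fun v => by
        change e ((1 : A) • e.symm v) = v
        rw [one_smul, Equiv.apply_symm_apply]
      map_mul' := fun g h => X.ext fun v => by
        change e ((g * h) • e.symm v) = e (g • e.symm (e (h • e.symm v)))
        rw [Equiv.symm_apply_apply, mul_smul] }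
  have hf : ∀ g v, (f g).1 v = e (g • e.symm v) := fun g v => rfl
  have hcont : Continuous f := X.continuous_iff.2 fun v w => by
    obtain ⟨a, ha⟩ := QuotientGroup.mk_surjective (e.symm v)
    obtain ⟨b, hb⟩ := QuotientGroup.mk_surjective (e.symm w)
    have : {g | (f g).1 v = w} = (fun g : A => (g * a)⁻¹ * b) ⁻¹' C.U := by
      ext g
      rw [Set.mem_preimage, SetLike.mem_coe, ← QuotientGroup.eq, hb, Set.mem_ofPred_eq, hf, ← ha,
        ← Equiv.eq_symm_apply]
      rfl
    rw [this]
    exact C.isOpen.preimage (by fun_prop)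
  -- The preimage of a vertex stabilizer is exactly the compact group `U`, whence properness;
  -- transitivity on cosets gives the covering.
  have hstab : ∀ g, f g ∈ X.stab (e ((1 : A) : A ⧸ C.U)) ↔ g ∈ C.U := fun g => by
    rw [PointedRegularTree.mem_stab, hf, Equiv.symm_apply_apply, e.injective.eq_iff, eq_comm]
    change ((1 : A) : A ⧸ C.U) = ((g * 1 : A) : A ⧸ C.U) ↔ _
    rw [QuotientGroup.eq]
    simp
  refine Copci.of_isCompact f hcont (X.stab (e ((1 : A) : A ⧸ C.U))) (X.isOpen_stab _)
    (X.isCompact_stab C.scale_ne_zero.bot_lt _) ?_ fun x => ?_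
  · convert! C.isCompact using 1
    ext g
    exact hstab g
  · obtain ⟨g, hg⟩ := QuotientGroup.mk_surjective (e.symm (x.1 (e ((1 : A) : A ⧸ C.U))))
    refine ⟨g, ?_⟩
    rw [PointedRegularTree.mem_stab, PointedRegularTree.mul_apply, ← map_inv, hf,
      ← hg, ← Equiv.eq_symm_apply, Equiv.symm_apply_apply]
    change ((g⁻¹ * g : A) : A ⧸ C.U) = _
    rw [inv_mul_cancel]

end Contraction

/-! ### Commations -/

theorem two_le_pow {q k : ℕ} (hq : 2 ≤ q) (hk : 1 ≤ k) : 2 ≤ q ^ k :=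
  hq.trans (Nat.le_self_pow (by omega) q)

/-- The group is `A^[n]`. The separate variable `m` lets powers of two different scales map to the
same tree group. -/
theorem Contraction.exists_isFocal_pow {A : TopGroup.{u}} [T2Space A] (C : Contraction A) {n : ℕ}
    (hn : 1 ≤ n) : ∃ K : TopGroup.{u}, IsFocal K ∧ Copci K A ∧
      ∀ m, C.scale ^ n = m → ∀ X : PointedRegularTree.{u} m, Copci K (FT X) :=
  ⟨TopGroup.of (C.focalDecomposition.powSubgroup n), (C.pow hn).isFocal, C.copci_subtype hn,
    fun _ hm X => (C.pow hn).copci_FT (by rw [C.scale_pow, hm]) X⟩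

namespace PointedRegularTree

variable {m : ℕ} (X : PointedRegularTree.{u} m)

theorem isFocal (hm : 2 ≤ m) : IsFocal (FT X) := by
  obtain ⟨C, -⟩ := X.exists_contraction hm (X.ray.vertex 0)
  exact C.isFocal

/-- A single decomposition serves all `n`: for `k ∣ n`, restrict to `FT_m^[n]` the map from
`FT_m^[k]` to `FT_{m ^ k}`. -/
theorem exists_focalDecomposition (hm : 2 ≤ m) : ∃ D : FocalDecomposition ℤ (FT X),
    ∀ n, 1 ≤ n → IsFocal (TopGroup.of (D.powSubgroup n)) ∧
      Copci (TopGroup.of (D.powSubgroup n)) (FT X) ∧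
      ∀ k, 1 ≤ k → k ∣ n → ∀ Y : PointedRegularTree.{u} (m ^ k),
        Copci (TopGroup.of (D.powSubgroup n)) (FT Y) := by
  obtain ⟨C, hC⟩ := X.exists_contraction hm (X.ray.vertex 0)
  refine ⟨C.focalDecomposition, fun n hn => ⟨(C.pow hn).isFocal, C.copci_subtype hn,
    fun k hk hkn Y => ?_⟩⟩
  have h1 : Copci (TopGroup.of (C.focalDecomposition.powSubgroup k)) (FT Y) :=
    (C.pow hk).copci_FT (by rw [C.scale_pow, hC]) Y
  obtain ⟨E, -⟩ := Y.exists_contraction (two_le_pow hm hk) (Y.ray.vertex 0)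
  have : LocallyCompactSpace (TopGroup.of (C.focalDecomposition.powSubgroup k)) :=
    (C.pow hk).locallyCompactSpace
  have : LocallyCompactSpace (FT Y) := E.locallyCompactSpace
  exact (C.copci_powSubgroup hn hkn).trans h1

end PointedRegularTree

theorem Commation.left {P : TopGroup.{u} → Prop} {w : List Arrow} {G H : TopGroup.{u}}
    (h : Commation P w G H) : P G := by
  cases w with
  | nil => exact h.1
  | cons a w => cases a <;> exact h.1

/-- Groups of totally disconnected type are preserved by commations within focal groups, and their
scales have a common power. -/
theorem Contraction.exists_of_commation {w : List Arrow} {G H : TopGroup.{u}} (C : Contraction G)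
    (h : Commation IsFocal w G H) : ∃ D : Contraction H, ∃ a b : ℕ, 1 ≤ a ∧ 1 ≤ b ∧
      C.scale ^ a = D.scale ^ b := by
  induction w generalizing G with
  | nil =>
    obtain ⟨-, rfl⟩ := h
    exact ⟨C, 1, 1, le_rfl, le_rfl, rfl⟩
  | cons arrow w ih =>
    cases arrow with
    | ne =>
      obtain ⟨-, K, hGK, hK⟩ := h
      obtain ⟨E⟩ := hK.left.nonempty_contraction_of_copci_right C hGK
      obtain ⟨D, a, b, ha, hb, hab⟩ := ih E hK
      obtain ⟨f, hf, _⟩ := hGK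
      obtain ⟨k, hk, hkE⟩ := C.exists_scale_eq_pow E hf
      refine ⟨D, a, k * b, ha, Nat.mul_pos hk hb, ?_⟩
      rw [hkE, ← pow_mul, mul_comm k a, pow_mul, hab, ← pow_mul, mul_comm]
    | nw =>
      obtain ⟨-, K, hKG, hK⟩ := h
      obtain ⟨E⟩ := hK.left.nonempty_contraction_of_copci_left C hKG
      obtain ⟨D, a, b, ha, hb, hab⟩ := ih E hK
      obtain ⟨f, hf, _⟩ := hKG
      obtain ⟨k, hk, hkE⟩ := E.exists_scale_eq_pow C hf
      refine ⟨D, k * a, b, Nat.mul_pos hk ha, hb, ?_⟩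
      rw [pow_mul, ← hkE, hab]

theorem Contraction.scale_unique {A : Type*} [Group A] [TopologicalSpace A] [IsTopologicalGroup A]
    (C D : Contraction A) : C.scale = D.scale := by
  have := C.locallyCompactSpace
  rw [← C.sInvariant_eq, ← D.sInvariant_eq]

theorem Contraction.exists_pow_eq_pow {w w' : List Arrow} {G H K : TopGroup.{u}}
    (C : Contraction G) (D : Contraction H) (hG : Commation IsFocal w G K)
    (hH : Commation IsFocal w' H K) : ∃ a b : ℕ, 1 ≤ a ∧ 1 ≤ b ∧ C.scale ^ a = D.scale ^ b := by
  obtain ⟨E, a, b, ha, hb, hab⟩ := C.exists_of_commation hG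
  obtain ⟨F, c, d, hc, hd, hcd⟩ := D.exists_of_commation hH
  rw [E.scale_unique F] at hab
  refine ⟨a * d, c * b, Nat.mul_pos ha hd, Nat.mul_pos hc hb, ?_⟩
  rw [pow_mul, hab, pow_mul, hcd, ← pow_mul, ← pow_mul, mul_comm]

theorem mainTheorem4 (G H : Type u)
    [Group G] [TopologicalSpace G] [IsTopologicalGroup G] [LocallyCompactSpace G]
    [Group H] [TopologicalSpace H] [IsTopologicalGroup H] [LocallyCompactSpace H]
    (hG : IsFocalTD (TopGroup.of G)) (hH : IsFocalTD (TopGroup.of H)) :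
    -- the invariants `s_G, s_H ≥ 2` are well defined
    (2 ≤ sInvariant G ∧ ModularRangeGeneratedBy G (sInvariant G)) ∧
    (2 ≤ sInvariant H ∧ ModularRangeGeneratedBy H (sInvariant H)) ∧
    -- the equivalent conditions
    List.TFAE [
      CommableWithin IsFocal (TopGroup.of G) (TopGroup.of H),
      qInvariant G = qInvariant H,
      ∃ a b : ℕ, 1 ≤ a ∧ 1 ≤ b ∧ sInvariant G ^ a = sInvariant H ^ b,
      Subgroup.Commensurable (modularRange G) (modularRange H),
      Commation IsFocal [Arrow.ne, Arrow.nw, Arrow.ne, Arrow.nw] (TopGroup.of G) (TopGroup.of H),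
      ∃ q n : ℕ, 2 ≤ q ∧ IsNonPower q ∧ 1 ≤ n ∧ ∀ X : PointedRegularTree.{u} q,
        ∃ D : FocalDecomposition ℤ (FT X),
          Commation IsFocal [Arrow.ne, Arrow.nw] (TopGroup.of G)
            (TopGroup.of (D.powSubgroup n)) ∧
          Commation IsFocal [Arrow.ne, Arrow.nw] (TopGroup.of H)
            (TopGroup.of (D.powSubgroup n)),
      ∃ q : ℕ, 2 ≤ q ∧ IsNonPower q ∧ ∀ X : PointedRegularTree.{u} q,
        Commation IsFocal [Arrow.ne, Arrow.nw, Arrow.ne] (TopGroup.of G) (FT X) ∧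
        Commation IsFocal [Arrow.ne, Arrow.nw, Arrow.ne] (TopGroup.of H) (FT X),
      Commation IsFocal [Arrow.nw, Arrow.ne, Arrow.nw, Arrow.ne] (TopGroup.of G) (TopGroup.of H),
      ∃ m : ℕ, 2 ≤ m ∧ ∀ X : PointedRegularTree.{u} m,
        Commation IsFocal [Arrow.nw, Arrow.ne] (TopGroup.of G) (FT X) ∧
        Commation IsFocal [Arrow.nw, Arrow.ne] (TopGroup.of H) (FT X)] ∧
    -- the explicit commation through the groups `FT_{q ^ k}`, where `q = q_G = q_H`
    (qInvariant G = qInvariant H →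
      2 ≤ qInvariant G ∧ IsNonPower (qInvariant G) ∧
      ∃ k l n : ℕ, 1 ≤ k ∧ 1 ≤ l ∧ 1 ≤ n ∧
        sInvariant G = qInvariant G ^ k ∧ sInvariant H = qInvariant G ^ l ∧
        ∀ (X : PointedRegularTree.{u} (qInvariant G))
          (Y : PointedRegularTree.{u} (qInvariant G ^ k))
          (Z : PointedRegularTree.{u} (qInvariant G ^ l)),
          IsFocal (FT Y) ∧ IsFocal (FT Z) ∧
          ∃ D : FocalDecomposition ℤ (FT X),
            IsFocal (TopGroup.of (D.powSubgroup n)) ∧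
            Copci (TopGroup.of G) (FT Y) ∧ Copci (TopGroup.of (D.powSubgroup n)) (FT Y) ∧
            Copci (TopGroup.of (D.powSubgroup n)) (FT Z) ∧ Copci (TopGroup.of H) (FT Z)) := by
  obtain ⟨C⟩ := hG.nonempty_contraction
  obtain ⟨D⟩ := hH.nonempty_contraction
  have : T2Space (TopGroup.of G) := hG.1.2
  have : T2Space (TopGroup.of H) := hH.1.2
  have hs : sInvariant G = C.scale := C.sInvariant_eq
  have hr : sInvariant H = D.scale := D.sInvariant_eq
  have hqG : qInvariant G = minRoot C.scale := by rw [← hs]; rfl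
  have hqH : qInvariant H = minRoot D.scale := by rw [← hr]; rfl
  have hq : qInvariant G = qInvariant H ↔
      ∃ a b : ℕ, 1 ≤ a ∧ 1 ≤ b ∧ C.scale ^ a = D.scale ^ b := by
    rw [hqG, hqH]
    exact minRoot_eq_iff C.two_le_scale D.two_le_scale
  have hFG : IsFocal (TopGroup.of G) := C.isFocal
  have hFH : IsFocal (TopGroup.of H) := D.isFocal
  have hroots : qInvariant G = qInvariant H → ∃ q k l : ℕ, q = qInvariant G ∧ 2 ≤ q ∧
      IsNonPower q ∧ 1 ≤ k ∧ 1 ≤ l ∧ C.scale = q ^ k ∧ D.scale = q ^ l := fun h => by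
    obtain ⟨h2, k, hk1, hk⟩ := minRoot_spec C.two_le_scale
    obtain ⟨-, l, hl1, hl⟩ := minRoot_spec D.two_le_scale
    rw [← hqH, ← h, hqG] at hl
    exact ⟨_, k, l, hqG.symm, h2, isNonPower_minRoot C.two_le_scale, hk1, hl1, hk, hl⟩
  rw [hs, hr]
  refine ⟨⟨C.two_le_scale, C.modularRangeGeneratedBy⟩,
    ⟨D.two_le_scale, D.modularRangeGeneratedBy⟩, ?_, fun h => ?_⟩
  · tfae_have 2 ↔ 3 := hq
    tfae_have 4 ↔ 3 := commensurable_modularRange_iff C.two_le_scale D.two_le_scale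
      C.modularRangeGeneratedBy D.modularRangeGeneratedBy
    tfae_have 1 → 3 := fun ⟨w, hw⟩ => C.exists_pow_eq_pow D hw (w' := []) ⟨hFH, rfl⟩
    tfae_have 5 → 1 := fun h => ⟨_, h⟩
    tfae_have 8 → 1 := fun h => ⟨_, h⟩
    tfae_have 6 → 3 := by
      rintro ⟨q, n, hq2, -, -, h⟩
      -- The condition quantifies over all pointed trees, so one must exist before it says anything.
      obtain ⟨X⟩ := PointedRegularTree.nonempty.{u} (by omega : 1 ≤ q)
      obtain ⟨E, h1, h2⟩ := h X
      exact C.exists_pow_eq_pow D h1 h2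
    tfae_have 7 → 3 := by
      rintro ⟨q, hq2, -, h⟩
      obtain ⟨X⟩ := PointedRegularTree.nonempty.{u} (by omega : 1 ≤ q)
      exact C.exists_pow_eq_pow D (h X).1 (h X).2
    tfae_have 9 → 3 := by
      rintro ⟨m, hm, h⟩
      obtain ⟨X⟩ := PointedRegularTree.nonempty.{u} (by omega : 1 ≤ m)
      exact C.exists_pow_eq_pow D (h X).1 (h X).2
    tfae_have 2 → 5 := by
      intro h
      obtain ⟨q, k, l, -, hq2, -, hk1, hl1, hk, hl⟩ := hroots h
      obtain ⟨X⟩ := PointedRegularTree.nonempty.{u} (by omega : 1 ≤ q)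
      obtain ⟨Y⟩ := PointedRegularTree.nonempty.{u} (Nat.one_le_pow k q (by omega))
      obtain ⟨Z⟩ := PointedRegularTree.nonempty.{u} (Nat.one_le_pow l q (by omega))
      obtain ⟨E, hE⟩ := X.exists_focalDecomposition hq2
      -- The index `k * l` is a common multiple of `k` and `l`, so `FT_q^[k * l]` maps to both
      -- `FT_{q ^ k}` and `FT_{q ^ l}`.
      have hP := hE (k * l) (Nat.mul_pos hk1 hl1)
      exact ⟨hFG, _, C.copci_FT hk Y, Y.isFocal (two_le_pow hq2 hk1), _,
        hP.2.2 k hk1 (Nat.dvd_mul_right k l) Y, hP.1, _,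
        hP.2.2 l hl1 (Nat.dvd_mul_left l k) Z, Z.isFocal (two_le_pow hq2 hl1), _,
        D.copci_FT hl Z, hFH, rfl⟩
    tfae_have 2 → 6 := by
      intro h
      obtain ⟨q, k, l, -, hq2, hnp, hk1, hl1, hk, hl⟩ := hroots h
      refine ⟨q, k * l, hq2, hnp, Nat.mul_pos hk1 hl1, fun X => ?_⟩
      obtain ⟨Y⟩ := PointedRegularTree.nonempty.{u} (Nat.one_le_pow k q (by omega))
      obtain ⟨Z⟩ := PointedRegularTree.nonempty.{u} (Nat.one_le_pow l q (by omega))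
      obtain ⟨E, hE⟩ := X.exists_focalDecomposition hq2
      have hP := hE (k * l) (Nat.mul_pos hk1 hl1)
      exact ⟨E, ⟨hFG, _, C.copci_FT hk Y, Y.isFocal (two_le_pow hq2 hk1), _,
        hP.2.2 k hk1 (Nat.dvd_mul_right k l) Y, hP.1, rfl⟩,
        ⟨hFH, _, D.copci_FT hl Z, Z.isFocal (two_le_pow hq2 hl1), _,
        hP.2.2 l hl1 (Nat.dvd_mul_left l k) Z, hP.1, rfl⟩⟩
    tfae_have 2 → 7 := by
      intro h
      obtain ⟨q, k, l, -, hq2, hnp, hk1, hl1, hk, hl⟩ := hroots h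
      refine ⟨q, hq2, hnp, fun X => ?_⟩
      obtain ⟨Y⟩ := PointedRegularTree.nonempty.{u} (Nat.one_le_pow k q (by omega))
      obtain ⟨Z⟩ := PointedRegularTree.nonempty.{u} (Nat.one_le_pow l q (by omega))
      obtain ⟨E, hE⟩ := X.exists_focalDecomposition hq2
      exact ⟨⟨hFG, _, C.copci_FT hk Y, Y.isFocal (two_le_pow hq2 hk1), _,
        (hE k hk1).2.2 k hk1 dvd_rfl Y, (hE k hk1).1, _, (hE k hk1).2.1, X.isFocal hq2, rfl⟩,
        ⟨hFH, _, D.copci_FT hl Z, Z.isFocal (two_le_pow hq2 hl1), _,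
        (hE l hl1).2.2 l hl1 dvd_rfl Z, (hE l hl1).1, _, (hE l hl1).2.1, X.isFocal hq2, rfl⟩⟩
    tfae_have 3 → 9 := by
      rintro ⟨a, b, ha, hb, hab⟩
      obtain ⟨K, hK, hKG, hKX⟩ := C.exists_isFocal_pow ha
      obtain ⟨L, hL, hLH, hLX⟩ := D.exists_isFocal_pow hb
      have hm := two_le_pow C.two_le_scale ha
      exact ⟨C.scale ^ a, hm, fun X =>
        ⟨⟨hFG, K, hKG, hK, _, hKX _ rfl X, X.isFocal hm, rfl⟩,
        ⟨hFH, L, hLH, hL, _, hLX _ hab.symm X, X.isFocal hm, rfl⟩⟩⟩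
    tfae_have 3 → 8 := by
      rintro ⟨a, b, ha, hb, hab⟩
      obtain ⟨K, hK, hKG, hKX⟩ := C.exists_isFocal_pow ha
      obtain ⟨L, hL, hLH, hLX⟩ := D.exists_isFocal_pow hb
      have hm := two_le_pow C.two_le_scale ha
      obtain ⟨X⟩ := PointedRegularTree.nonempty.{u} (by omega : 1 ≤ C.scale ^ a)
      exact ⟨hFG, K, hKG, hK, _, hKX _ rfl X, X.isFocal hm, L, hLX _ hab.symm X, hL, _, hLH,
        hFH, rfl⟩
    tfae_finish
  · obtain ⟨q, k, l, hqq, hq2, hnp, hk1, hl1, hk, hl⟩ := hroots h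
    rw [← hqq]
    refine ⟨hq2, hnp, k, l, k * l, hk1, hl1, Nat.mul_pos hk1 hl1, hk, hl, fun X Y Z => ?_⟩
    obtain ⟨E, hE⟩ := X.exists_focalDecomposition hq2
    have hP := hE (k * l) (Nat.mul_pos hk1 hl1)
    exact ⟨Y.isFocal (two_le_pow hq2 hk1), Z.isFocal (two_le_pow hq2 hl1), E, hP.1,
      C.copci_FT hk Y, hP.2.2 k hk1 (Nat.dvd_mul_right k l) Y,
      hP.2.2 l hl1 (Nat.dvd_mul_left l k) Z, D.copci_FT hl Z⟩
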